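/- A finite group is Fitting-free if it has no nontrivial abelian normal subgroup. Let $t:\mathbb{N}\to\mathbb{N}$ be nondecreasing. Suppose that some (deterministic, multi-stack) Turing machine, given the multiplication tables of any two Fitting-free groups of the same order $N$ (the elements labelled $0,\dots,N-1$ in any way, the table entries written in binary), decides in time $O(t(N))$ whether the two groups are isomorphic. Then some Turing machine, given any two linear codes $C, D\le\mathbb{F}_2^n$ (for any $n$), each by a generator matrix whose rows are a basis of the code, decides in time $O(t(240^n))$ whether $C$ and $D$ are equivalent, i.e. whether they have the same dimension $d$ and $d\times n$ generator matrices $A$ of $C$ and $B$ of $D$ with $B=TAP$ for some $T\in\mathrm{GL}_d(\mathbb{F}_2)$ and some $n\times n$ permutation matrix $P$. In other words, if isomorphism of Fitting-free groups of order $N$ can be decided in time $O(t(N))$, then Linear Code Equivalence for codes in $\mathbb{F}_2^n$ can be decided in time $O(t(240^n))$. -/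

import Mathlib

/-- The symbols that occur in inputs: two bits and two delimiters. -/
inductive InputSymbol : Type
  | bit (b : Bool)
  | comma
  | semicolon

/-- A decision problem with instances `ι`, encoded as strings by `encode`, whose yes-instances are
given by `yes`, is decidable in time `O(time)`: there are one multi-stack Turing machine (with
finitely many stacks, labels, internal states and stack symbols) and one constant `c` such that, on
the encoding of every instance `x`, the machine halts after at most `c * time x` steps, with the
answer bit as its only output. Here `time x` may depend on any parameter of the instance `x`. -/
def DecidableInTime {ι : Type*} (encode : ι → List InputSymbol) (yes : ι → Prop)
    (time : ι → ℕ) : Prop :=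
  ∃ (M : Turing.TM2ComputableAux InputSymbol Bool) (c : ℕ),
    (∀ k, Finite (M.tm.Γ k)) ∧
    ∀ (x : ι) (answer : Bool), (answer = true ↔ yes x) →
      Nonempty (Turing.TM2OutputsInTime M.tm
        ((encode x).map M.inputAlphabet.symm)
        (some ([answer].map M.outputAlphabet.symm))
        (c * time x))

/-- A natural number in binary (least significant bit first; zero is the empty string). -/
def encodeNat (a : ℕ) : List InputSymbol :=
  (Nat.bits a).map InputSymbol.bit

/-! ### Fitting-free groups given by multiplication tables -/

/-- A group is Fitting-free if it has no nontrivial abelian normal subgroup. -/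
def FittingFree (G : Type*) [Group G] : Prop :=
  ∀ A : Subgroup G, A.Normal → (∀ x ∈ A, ∀ y ∈ A, x * y = y * x) → A = ⊥

/-- The multiplication (Cayley) table of a group whose elements are labelled `0, …, N - 1`. -/
def cayleyTable {G : Type*} [Group G] {N : ℕ} (label : G ≃ Fin N) :
    Matrix (Fin N) (Fin N) (Fin N) :=
  Matrix.of fun i j => label (label.symm i * label.symm j)

/-- A table is written row by row, each entry in binary and followed by a comma, each row followed
by a semicolon. -/
def encodeTable {N : ℕ} (T : Matrix (Fin N) (Fin N) (Fin N)) : List InputSymbol :=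
  (List.finRange N).flatMap fun i =>
    ((List.finRange N).flatMap fun j => encodeNat (T i j) ++ [InputSymbol.comma]) ++
      [InputSymbol.semicolon]

/-- An instance of isomorphism testing of Fitting-free groups: two Fitting-free groups of the same
order, each with an arbitrary labelling of its elements. -/
structure FittingFreePair where
  order : ℕ
  G : Type
  H : Type
  [groupG : Group G]
  [groupH : Group H]
  labelG : G ≃ Fin order
  labelH : H ≃ Fin order
  fittingFreeG : FittingFree G
  fittingFreeH : FittingFree H

attribute [instance] FittingFreePair.groupG FittingFreePair.groupH

/-- The input string: the two multiplication tables, with an additional semicolon in between. -/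
def FittingFreePair.encode (x : FittingFreePair) : List InputSymbol :=
  encodeTable (cayleyTable x.labelG) ++ [InputSymbol.semicolon] ++
    encodeTable (cayleyTable x.labelH)

/-- The question: are the two groups isomorphic? -/
def FittingFreePair.Isomorphic (x : FittingFreePair) : Prop :=
  Nonempty (x.G ≃* x.H)

/-! ### Linear codes over the field with two elements, given by generator matrices -/

/-- A binary linear code of length `n`. -/
abbrev BinaryCode (n : ℕ) : Type := Submodule (ZMod 2) (Fin n → ZMod 2)

/-- The rows of the `d × n` matrix `A` are a basis of the code `C`; so `C` is `d`-dimensional. -/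
def IsGeneratorMatrix {d n : ℕ} (A : Matrix (Fin d) (Fin n) (ZMod 2)) (C : BinaryCode n) : Prop :=
  LinearIndependent (ZMod 2) A.row ∧ Submodule.span (ZMod 2) (Set.range A.row) = C

/-- Two binary codes of length `n` are equivalent if they have the same dimension `d` and
generator matrices `A`, `B` with `B = T * A * P`, where `T` is an invertible `d × d` matrix and `P`
is an `n × n` permutation matrix. -/
def LinearCodeEquivalent {n : ℕ} (C D : BinaryCode n) : Prop :=
  ∃ (d : ℕ) (A B : Matrix (Fin d) (Fin n) (ZMod 2)),
    IsGeneratorMatrix A C ∧ IsGeneratorMatrix B D ∧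
      ∃ (T : Matrix.GeneralLinearGroup (Fin d) (ZMod 2)) (σ : Equiv.Perm (Fin n)),
        B = (T : Matrix (Fin d) (Fin d) (ZMod 2)) * A * σ.permMatrix (ZMod 2)

/-- A bit matrix is written row by row, each row followed by a comma, with a final semicolon. -/
def encodeMatrix {d n : ℕ} (A : Matrix (Fin d) (Fin n) (ZMod 2)) : List InputSymbol :=
  ((List.finRange d).flatMap fun i =>
    ((List.finRange n).map fun j => InputSymbol.bit (decide (A i j = 1))) ++ [InputSymbol.comma]) ++
      [InputSymbol.semicolon]

/-- An instance of linear code equivalence over the field with two elements: two codes of the same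
length `n`, each with a generator matrix. -/
structure CodePair where
  n : ℕ
  C : BinaryCode n
  D : BinaryCode n
  dimC : ℕ
  dimD : ℕ
  genC : Matrix (Fin dimC) (Fin n) (ZMod 2)
  genD : Matrix (Fin dimD) (Fin n) (ZMod 2)
  isGeneratorMatrixC : IsGeneratorMatrix genC C
  isGeneratorMatrixD : IsGeneratorMatrix genD D

/-- The input string: the length `n` in unary, followed by the two generator matrices. -/
def CodePair.encode (x : CodePair) : List InputSymbol :=
  List.replicate x.n (InputSymbol.bit true) ++ [InputSymbol.semicolon] ++
    encodeMatrix x.genC ++ encodeMatrix x.genD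

/-- The question: are the two codes equivalent? -/
def CodePair.Equivalent (x : CodePair) : Prop :=
  LinearCodeEquivalent x.C x.D

/-! To a code $C$ attach the group $G_C$ of all $g\in S_5^n$ whose vector of parities lies in $C$;
it is an extension of $C$ by $A_5^n$ and has order $60^n2^d\le120^n$. As $A_5$ is simple and has
trivial centralizer in $S_5$, a commutator argument shows that every nontrivial normal subgroup of
$G_C$ contains one of the $n$ factors $A_5$ (`codeGroup.exists_factor_le`). Hence $G_C$ is
Fitting-free, and the factors are its minimal normal subgroups, so an isomorphism $G_C\to G_D$
permutes them. The $k$-th component of $x$ is even exactly if $x$ acts on the $k$-th factor like an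
element of that factor (`codeGroup.parityBit_eq_zero_iff`). So the isomorphism also respects
parities and gives a permutation of coordinates taking $C$ to $D$; the converse is clear
(`linearCodeEquivalent_iff`). Codes of different dimensions are inequivalent and need no groups.

The tables have to be written by a Turing machine. A group element becomes a word, its components
followed by the coefficients of its parity vector in the given basis. Words multiply coordinatewise
and are listed in the order of a mixed-radix label, so the label of a product is computed without
any search (`exists_label`). The algorithm is a program in a small language of stack operations,
which is compiled (`StackProgram.Runs.stepsWithin`) and placed in front of the given machine
(`StackProgram.preprocessed_execute`). It takes $O((120^n)^2(2n+1)^2)$ steps.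

This cost must be $O(t(240^n))$, although $t$ is only known to be monotone. But the given machine
ends with its input removed, so $t(N)$ is at least of order $N^2$ for each order $N=60^k=|A_5^k|$
(`sq_le_of_decides`). Take $k=\lfloor4n/3\rfloor$. Then $60^k\le240^n$ because $60^4<240^3$, and
since $60^4$ is $7.5$ times $120^3$, the number $60^{2k}$ also absorbs the polynomial factor
(`sq_mul_pow_le`). -/

/-! ### Stack programs and their compilation to multi-stack Turing machines -/

open StateTransition Turing

/-- `StepsWithin f a b t`: iterating `f` leads from `a` to `b` in at most `t` steps. -/
def StepsWithin {C : Type*} (f : C → Option C) (a b : C) (t : ℕ) : Prop :=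
  Nonempty (EvalsToInTime f a (some b) t)

namespace StepsWithin

variable {C : Type*} {f : C → Option C} {a b c : C} {s t u : ℕ}

theorem trans (h₁ : StepsWithin f a b s) (h₂ : StepsWithin f b c t) (h : s + t ≤ u) :
    StepsWithin f a c u := by
  obtain ⟨h₁⟩ := h₁
  obtain ⟨h₂⟩ := h₂
  let e := EvalsToInTime.trans f s t a b (some c) h₁ h₂
  exact ⟨⟨e.toEvalsTo, by have := e.steps_le_m; omega⟩⟩

theorem single (h : f a = some b) (ht : 1 ≤ t) : StepsWithin f a b t :=
  ⟨⟨⟨1, by simpa [flip] using h⟩, ht⟩⟩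

theorem step (h : f a = some b) (h' : StepsWithin f b c s) (hu : s + 1 ≤ u) :
    StepsWithin f a c u :=
  (single h le_rfl).trans h' (by omega)

end StepsWithin

/-- Programs acting on stacks indexed by `K` with entries in `Γ`: `branch k f` pops the stack `k` and
continues according to the result; `loop k c f` repeatedly pops the stack `k` and executes `f a` for
the symbol `a` obtained, until the stack is empty or `c a` is false. -/
inductive StackProgram (K Γ : Type) : Type
  | skip
  | push (k : K) (a : Γ)
  | seq (p q : StackProgram K Γ)
  | branch (k : K) (f : Option Γ → StackProgram K Γ)
  | loop (k : K) (c : Γ → Bool) (f : Γ → StackProgram K Γ)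

namespace StackProgram

variable {K Γ : Type}

/-- `Runs p S S' t`: started with the stacks `S`, the program `p` ends with the stacks `S'` after
at most `t` steps. -/
inductive Runs [DecidableEq K] : StackProgram K Γ → (K → List Γ) → (K → List Γ) → ℕ → Prop
  | skip {S t} (h : 1 ≤ t) : Runs skip S S t
  | push {k a S t} (h : 1 ≤ t) : Runs (push k a) S (Function.update S k (a :: S k)) t
  | seq {p q S₁ S₂ S₃ s t u} (hp : Runs p S₁ S₂ s) (hq : Runs q S₂ S₃ t) (h : s + t ≤ u) :
      Runs (seq p q) S₁ S₃ u
  | branch {k f S S' t u}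
      (h : Runs (f (S k).head?) (Function.update S k (S k).tail) S' t) (hu : t + 1 ≤ u) :
      Runs (branch k f) S S' u
  | loop_nil {k c f S t} (hk : S k = []) (h : 1 ≤ t) : Runs (loop k c f) S S t
  | loop_exit {k c f S a l t} (hk : S k = a :: l) (ha : c a = false) (h : 1 ≤ t) :
      Runs (loop k c f) S (Function.update S k l) t
  | loop_cons {k c f S S₁ S₂ a l s t u} (hk : S k = a :: l) (ha : c a = true)
      (hf : Runs (f a) (Function.update S k l) S₁ s) (hr : Runs (loop k c f) S₁ S₂ t)
      (h : s + t + 1 ≤ u) : Runs (loop k c f) S S₂ u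

/-- The labels of the machine code of a program. -/
def Label : StackProgram K Γ → Type
  | skip => Unit
  | push _ _ => Unit
  | seq p q => p.Label ⊕ q.Label
  | branch _ f => Option (Σ o, (f o).Label)
  | loop _ _ f => Option (Σ a, (f a).Label)

/-- The first label of the machine code of a program. -/
def entry : (p : StackProgram K Γ) → p.Label
  | skip => ()
  | push _ _ => ()
  | seq p _ => Sum.inl p.entry
  | branch _ _ => none
  | loop _ _ _ => none

/-- A branch or loop keeps a separate copy of code for each symbol it may pop, so finiteness of the
alphabet is what makes the compiled program a legitimate finite control. -/
theorem finite_label [Finite Γ] (p : StackProgram K Γ) : Finite p.Label := by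
  induction p with
  | skip => exact inferInstanceAs (Finite Unit)
  | push => exact inferInstanceAs (Finite Unit)
  | seq p q hp hq => exact inferInstanceAs (Finite (p.Label ⊕ q.Label))
  | branch k f h => exact inferInstanceAs (Finite (Option (Σ o, (f o).Label)))
  | loop k c f h => exact inferInstanceAs (Finite (Option (Σ a, (f a).Label)))

/-- The stack alphabets of a machine that has the stacks of a program beside further stacks. -/
abbrev Alphabet {J : Type} (Δ : J → Type) (K Γ : Type) : J ⊕ K → Type := Sum.elim Δ fun _ => Γ

section

variable {J : Type} {Δ : J → Type} {L σ : Type}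

/-- Pushing to a stack of the program. -/
def pushProgram (k : K) (f : σ → Γ) (q : TM2.Stmt (Alphabet Δ K Γ) L σ) :
    TM2.Stmt (Alphabet Δ K Γ) L σ :=
  .push (Sum.inr k) f q

/-- Popping from a stack of the program. -/
def popProgram (k : K) (f : σ → Option Γ → σ) (q : TM2.Stmt (Alphabet Δ K Γ) L σ) :
    TM2.Stmt (Alphabet Δ K Γ) L σ :=
  .pop (Sum.inr k) f q

/-- Pushing to one of the further stacks. -/
def pushFurther (j : J) (f : σ → Δ j) (q : TM2.Stmt (Alphabet Δ K Γ) L σ) :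
    TM2.Stmt (Alphabet Δ K Γ) L σ :=
  .push (Sum.inl j) f q

/-- Popping from one of the further stacks. -/
def popFurther (j : J) (f : σ → Option (Δ j) → σ) (q : TM2.Stmt (Alphabet Δ K Γ) L σ) :
    TM2.Stmt (Alphabet Δ K Γ) L σ :=
  .pop (Sum.inl j) f q

end

/-- The machine code of a program, with its labels embedded by `emb` and leaving to `exit`. -/
def code {J : Type} (Δ : J → Type) (τ : Type) {L : Type} :
    (p : StackProgram K Γ) → (p.Label → L) → L → p.Label →
      TM2.Stmt (Alphabet Δ K Γ) L (τ × Option Γ)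
  | skip, _, exit, _ => .goto fun _ => exit
  | push k a, _, exit, _ => pushProgram k (fun _ => a) (.goto fun _ => exit)
  | seq p q, emb, _, Sum.inl l => p.code Δ τ (fun l => emb (Sum.inl l)) (emb (Sum.inr q.entry)) l
  | seq _ q, emb, exit, Sum.inr l => q.code Δ τ (fun l => emb (Sum.inr l)) exit l
  | branch k f, emb, _, none =>
      popProgram k (fun v o => (v.1, o)) (.goto fun v => emb (some ⟨v.2, (f v.2).entry⟩))
  | branch _ f, emb, exit, some ⟨o, l⟩ => (f o).code Δ τ (fun l => emb (some ⟨o, l⟩)) exit l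
  | loop k c f, emb, exit, none =>
      popProgram k (fun v o => (v.1, o)) (.goto fun v =>
        match v.2 with
        | none => exit
        | some a => if c a then emb (some ⟨a, (f a).entry⟩) else exit)
  | loop _ _ f, emb, _, some ⟨a, l⟩ => (f a).code Δ τ (fun l => emb (some ⟨a, l⟩)) (emb none) l

/-- The stacks of a machine that has the stacks `S` of a program beside further stacks `D`. -/
def joinStacks {J : Type} {Δ : J → Type} (D : ∀ j, List (Δ j)) (S : K → List Γ) :
    ∀ k, List (Alphabet Δ K Γ k)
  | Sum.inl j => D j
  | Sum.inr k => S k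

section

variable [DecidableEq K] {J : Type} [DecidableEq J] {Δ : J → Type} (D : ∀ j, List (Δ j)) (S : K → List Γ)

theorem update_joinStacks_inr (k : K) (l : List Γ) :
    Function.update (joinStacks D S) (Sum.inr k) l = joinStacks D (Function.update S k l) := by
  funext i
  rcases i with j | i
  · exact Function.update_of_ne (by simp) _ _
  · by_cases h : i = k
    · subst h
      exact (Function.update_self _ _ _).trans (Function.update_self i l S).symm
    · exact (Function.update_of_ne (by simpa using h) _ _).trans (Function.update_of_ne h _ _).symm

theorem update_joinStacks_inl (j : J) (l : List (Δ j)) :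
    Function.update (joinStacks D S) (Sum.inl j) l = joinStacks (Function.update D j l) S := by
  funext i
  rcases i with i | k
  · by_cases h : i = j
    · subst h
      exact (Function.update_self _ _ _).trans (Function.update_self i l D).symm
    · exact (Function.update_of_ne (by simpa using h) _ _).trans (Function.update_of_ne h _ _).symm
  · exact Function.update_of_ne (by simp) _ _

variable {L σ : Type}

theorem stepAux_pushProgram (k : K) (f : σ → Γ) (q : TM2.Stmt (Alphabet Δ K Γ) L σ) (v : σ) :
    TM2.stepAux (pushProgram k f q) v (joinStacks D S) =
      TM2.stepAux q v (joinStacks D (Function.update S k (f v :: S k))) := by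
  rw [← update_joinStacks_inr]
  rfl

theorem stepAux_popProgram (k : K) (f : σ → Option Γ → σ) (q : TM2.Stmt (Alphabet Δ K Γ) L σ) (v : σ) :
    TM2.stepAux (popProgram k f q) v (joinStacks D S) =
      TM2.stepAux q (f v (S k).head?) (joinStacks D (Function.update S k (S k).tail)) := by
  rw [← update_joinStacks_inr]
  rfl

theorem stepAux_pushFurther (j : J) (f : σ → Δ j) (q : TM2.Stmt (Alphabet Δ K Γ) L σ) (v : σ) :
    TM2.stepAux (pushFurther j f q) v (joinStacks D S) =
      TM2.stepAux q v (joinStacks (Function.update D j (f v :: D j)) S) := by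
  rw [← update_joinStacks_inl]
  rfl

theorem stepAux_popFurther (j : J) (f : σ → Option (Δ j) → σ) (q : TM2.Stmt (Alphabet Δ K Γ) L σ)
    (v : σ) :
    TM2.stepAux (popFurther j f q) v (joinStacks D S) =
      TM2.stepAux q (f v (D j).head?) (joinStacks (Function.update D j (D j).tail) S) := by
  rw [← update_joinStacks_inl]
  rfl

end

/-- Correctness of the compiler, by induction on the run: every unit of time counted in `Runs` pays
for one machine step. The embedding and the exit are arbitrary because a subprogram is compiled
inside its context. The register of the last popped symbol may end with anything, whereas `v` and
the further stacks are never touched. -/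
theorem Runs.stepsWithin [DecidableEq K] {J : Type} [DecidableEq J] {Δ : J → Type} {τ L : Type}
    (m : L → TM2.Stmt (Alphabet Δ K Γ) L (τ × Option Γ)) (D : ∀ j, List (Δ j)) (v : τ)
    {p : StackProgram K Γ} {S S' : K → List Γ} {t : ℕ} (h : Runs p S S' t) :
    ∀ (emb : p.Label → L) (exit : L), (∀ l, m (emb l) = p.code Δ τ emb exit l) →
      ∀ o : Option Γ, ∃ o' : Option Γ,
        StepsWithin (TM2.step m) ⟨some (emb p.entry), (v, o), joinStacks D S⟩
          ⟨some exit, (v, o'), joinStacks D S'⟩ t := by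
  induction h with
  | skip h =>
    intro emb exit hm o
    refine ⟨o, StepsWithin.single ?_ h⟩
    rw [TM2.step, hm]
    rfl
  | push h =>
    intro emb exit hm o
    refine ⟨o, StepsWithin.single ?_ h⟩
    rw [TM2.step, hm, code, stepAux_pushProgram]
    rfl
  | @seq p q _ _ _ _ _ _ _ _ h ihp ihq =>
    intro emb exit hm o
    obtain ⟨o₁, h₁⟩ := ihp (fun l => emb (Sum.inl l)) (emb (Sum.inr q.entry))
      (fun l => hm (Sum.inl l)) o
    obtain ⟨o₂, h₂⟩ := ihq (fun l => emb (Sum.inr l)) exit (fun l => hm (Sum.inr l)) o₁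
    exact ⟨o₂, h₁.trans h₂ h⟩
  | @branch k f S _ _ _ _ hu ih =>
    intro emb exit hm o
    obtain ⟨o', h'⟩ := ih (fun l => emb (some ⟨_, l⟩)) exit (fun l => hm (some ⟨_, l⟩)) (S k).head?
    refine ⟨o', h'.step ?_ hu⟩
    rw [TM2.step, hm, entry, code, stepAux_popProgram]
    rfl
  | @loop_nil k c f S t hk h =>
    intro emb exit hm o
    refine ⟨none, StepsWithin.single ?_ h⟩
    have e : Function.update S k (S k).tail = S := by rw [hk, List.tail_nil, ← hk]; simp
    rw [TM2.step, hm, entry, code, stepAux_popProgram, e, hk]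
    rfl
  | @loop_exit k c f S a l t hk ha h =>
    intro emb exit hm o
    refine ⟨some a, StepsWithin.single ?_ h⟩
    rw [TM2.step, hm, entry, code, stepAux_popProgram, hk]
    simp [ha]
  | @loop_cons k c f S _ _ a l _ _ _ hk ha _ _ h ihf ihr =>
    intro emb exit hm o
    obtain ⟨o₁, h₁⟩ := ihf (fun l => emb (some ⟨_, l⟩)) (emb none) (fun l => hm (some ⟨_, l⟩))
      (some a)
    obtain ⟨o₂, h₂⟩ := ihr emb exit hm o₁
    refine ⟨o₂, (h₁.trans h₂ le_rfl).step ?_ h⟩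
    rw [TM2.step, hm, entry, code, stepAux_popProgram, hk]
    simp [ha]

end StackProgram

/-! ### Preprocessing the input of a machine by a stack program -/

theorem Turing.initList_eq (tm : FinTM2) (s : List (tm.Γ tm.k₀)) :
    initList tm s = ⟨some tm.main, tm.initialState, Function.update (fun _ => []) tm.k₀ s⟩ := by
  refine congrArg (TM2.Cfg.mk (some tm.main) tm.initialState) ?_
  funext k
  by_cases h : k = tm.k₀
  · subst h
    rw [Function.update_self, dif_pos rfl]
    rfl
  · rw [Function.update_of_ne h, dif_neg h]

theorem Turing.haltList_eq (tm : FinTM2) (s : List (tm.Γ tm.k₁)) :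
    haltList tm s = ⟨none, tm.initialState, Function.update (fun _ => []) tm.k₁ s⟩ := by
  refine congrArg (TM2.Cfg.mk none tm.initialState) ?_
  funext k
  by_cases h : k = tm.k₁
  · subst h
    rw [Function.update_self, dif_pos rfl]
    rfl
  · rw [Function.update_of_ne h, dif_neg h]

namespace StackProgram

/-! ### Running a machine beside idle program stacks -/

section Lift

variable {K Γ : Type} [DecidableEq K] {J : Type} [DecidableEq J] {Δ : J → Type} {Λ L τ : Type}

/-- A statement of a machine, as a statement of a machine with the further stacks of a program. -/
def liftStmt (emb : Λ → L) : TM2.Stmt Δ Λ τ → TM2.Stmt (Alphabet Δ K Γ) L (τ × Option Γ)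
  | .push j f q => pushFurther j (fun v => f v.1) (liftStmt emb q)
  | .peek j f q => .peek (Sum.inl j) (fun v o => (f v.1 o, v.2)) (liftStmt emb q)
  | .pop j f q => popFurther j (fun v o => (f v.1 o, v.2)) (liftStmt emb q)
  | .load f q => .load (fun v => (f v.1, v.2)) (liftStmt emb q)
  | .branch f q₁ q₂ => .branch (fun v => f v.1) (liftStmt emb q₁) (liftStmt emb q₂)
  | .goto f => .goto fun v => emb (f v.1)
  | .halt => .halt

/-- A configuration of a machine, as one of a machine with the further stacks of a program. -/
def liftCfg (emb : Λ → L) (o : Option Γ) (S : K → List Γ) (c : TM2.Cfg Δ Λ τ) :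
    TM2.Cfg (Alphabet Δ K Γ) L (τ × Option Γ) :=
  ⟨c.l.map emb, (c.var, o), joinStacks c.stk S⟩

theorem stepAux_liftStmt (emb : Λ → L) (o : Option Γ) (S : K → List Γ) (q : TM2.Stmt Δ Λ τ) :
    ∀ (v : τ) (D : ∀ j, List (Δ j)), TM2.stepAux (liftStmt emb q) (v, o) (joinStacks D S) =
      liftCfg emb o S (TM2.stepAux q v D) := by
  induction q with
  | push j f q ih =>
    intro v D
    rw [liftStmt, stepAux_pushFurther, ih]
    rfl
  | peek j f q ih =>
    intro v D
    exact ih (f v (D j).head?) D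
  | pop j f q ih =>
    intro v D
    rw [liftStmt, stepAux_popFurther, ih]
    rfl
  | load f q ih =>
    intro v D
    exact ih (f v) D
  | branch f q₁ q₂ ih₁ ih₂ =>
    intro v D
    rw [liftStmt, TM2.stepAux, TM2.stepAux]
    cases h : f v
    · exact ih₂ v D
    · exact ih₁ v D
  | goto f => intro v D; rfl
  | halt => intro v D; rfl

/-- `liftCfg` semiconjugates the two step functions, halting included, so the iterates correspond
and the number of steps is unchanged. -/
theorem StepsWithin.lift {m : Λ → TM2.Stmt Δ Λ τ}
    {m' : L → TM2.Stmt (Alphabet Δ K Γ) L (τ × Option Γ)} {emb : Λ → L}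
    (hm : ∀ l, m' (emb l) = liftStmt emb (m l)) (o : Option Γ) (S : K → List Γ)
    {a b : TM2.Cfg Δ Λ τ} {t : ℕ} (h : StepsWithin (TM2.step m) a b t) :
    StepsWithin (TM2.step m') (liftCfg emb o S a) (liftCfg emb o S b) t := by
  have key : ∀ c, TM2.step m' (liftCfg emb o S c) = (TM2.step m c).map (liftCfg emb o S) := by
    rintro ⟨l, v, D⟩
    cases l with
    | none => rfl
    | some l =>
      change some (TM2.stepAux (m' (emb l)) (v, o) (joinStacks D S)) = _
      rw [hm, stepAux_liftStmt]
      rfl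
  have semi : Function.Semiconj (Option.map (liftCfg emb o S)) (flip bind (TM2.step m))
      (flip bind (TM2.step m')) := by
    intro c
    cases c with
    | none => rfl
    | some c => exact (key c).symm
  obtain ⟨⟨⟨n, hn⟩, ht⟩⟩ := h
  refine ⟨⟨⟨n, ?_⟩, ht⟩⟩
  have := (semi.iterate_right n) (some a)
  rw [hn] at this
  exact this.symm

end Lift

variable {K Γ : Type} [DecidableEq K]

/-- The labels of `preprocessed`: those of the machine, those of the program, and three labels
for transferring the input to the program, for testing whether it has an output, and for transferring
the output to the machine. -/
abbrev PreprocessedLabel (M : TM2ComputableAux InputSymbol Bool) (p : StackProgram K Γ) : Type :=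
  M.tm.Λ ⊕ p.Label ⊕ Fin 3

/-- The code of `preprocessed`. -/
def preprocessedCode (M : TM2ComputableAux InputSymbol Bool) (p : StackProgram K Γ)
    (kin kout : K) (inj : InputSymbol → Γ) (proj : Γ → InputSymbol) :
    PreprocessedLabel M p → TM2.Stmt (Alphabet M.tm.Γ K Γ) (PreprocessedLabel M p)
      (M.tm.σ × Option Γ)
  | Sum.inl l => liftStmt Sum.inl (M.tm.m l)
  | Sum.inr (Sum.inl l) =>
      p.code M.tm.Γ M.tm.σ (fun l => Sum.inr (Sum.inl l)) (Sum.inr (Sum.inr 1)) l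
  | Sum.inr (Sum.inr 0) =>
      popFurther M.tm.k₀ (fun v o => (v.1, o.map fun a => inj (M.inputAlphabet a))) <|
        .branch (fun v => v.2.isSome)
          (pushProgram kin (fun v => v.2.getD (inj .comma)) (.goto fun _ => Sum.inr (Sum.inr 0)))
          (.goto fun _ => Sum.inr (Sum.inl p.entry))
  | Sum.inr (Sum.inr 1) =>
      popProgram kout (fun v o => (v.1, o)) <|
        .branch (fun v => v.2.isSome)
          (pushFurther M.tm.k₀ (fun v => M.inputAlphabet.symm (proj (v.2.getD (inj .comma))))
            (.goto fun _ => Sum.inr (Sum.inr 2)))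
          (pushFurther M.tm.k₁ (fun _ => M.outputAlphabet.symm false) .halt)
  | Sum.inr (Sum.inr 2) =>
      popProgram kout (fun v o => (v.1, o)) <|
        .branch (fun v => v.2.isSome)
          (pushFurther M.tm.k₀ (fun v => M.inputAlphabet.symm (proj (v.2.getD (inj .comma))))
            (.goto fun _ => Sum.inr (Sum.inr 2)))
          (.goto fun _ => Sum.inl M.tm.main)

/-- The machine that transfers its input to the stack `kin`, executes the program `p`, and
executes the machine `M` on the contents of `kout`, unless there are none, when it answers no. -/
noncomputable def preprocessed [Finite K] [Finite Γ] (M : TM2ComputableAux InputSymbol Bool) (p : StackProgram K Γ)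
    (kin kout : K) (inj : InputSymbol → Γ) (proj : Γ → InputSymbol) :
    TM2ComputableAux InputSymbol Bool :=
  letI := M.tm.kFin
  letI := M.tm.ΛFin
  letI := M.tm.σFin
  letI := Fintype.ofFinite K
  letI := Fintype.ofFinite Γ
  letI := p.finite_label
  letI := Fintype.ofFinite p.Label
  { tm :=
      { K := M.tm.K ⊕ K
        k₀ := Sum.inl M.tm.k₀
        k₁ := Sum.inl M.tm.k₁
        Γ := Alphabet M.tm.Γ K Γ
        Λ := PreprocessedLabel M p
        main := Sum.inr (Sum.inr 0)
        σ := M.tm.σ × Option Γ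
        initialState := (M.tm.initialState, none)
        Γk₀Fin := M.tm.Γk₀Fin
        m := preprocessedCode M p kin kout inj proj }
    inputAlphabet := M.inputAlphabet
    outputAlphabet := M.outputAlphabet }

section

variable (M : TM2ComputableAux InputSymbol Bool) (p : StackProgram K Γ)
  (kin kout : K) (inj : InputSymbol → Γ) (proj : Γ → InputSymbol)

local notation "mach" => preprocessedCode M p kin kout inj proj

/-- Popping and pushing reverses the input. The last pop finds the stack empty and thereby resets
the register to `none`; the initial register `o` is arbitrary for the sake of the induction. -/
theorem preprocessed_load (s : List InputSymbol) :
    ∀ (l : List Γ) (o : Option Γ), StepsWithin (TM2.step mach)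
      ⟨some (Sum.inr (Sum.inr 0)), (M.tm.initialState, o),
        joinStacks (Function.update (fun _ => []) M.tm.k₀ (s.map M.inputAlphabet.symm))
          (Function.update (fun _ => []) kin l)⟩
      ⟨some (Sum.inr (Sum.inl p.entry)), (M.tm.initialState, none),
        joinStacks (fun _ => []) (Function.update (fun _ => []) kin (s.reverse.map inj ++ l))⟩
      (s.length + 1) := by
  induction s with
  | nil =>
    intro l o
    refine StepsWithin.single ?_ (by simp)
    rw [TM2.step, preprocessedCode, stepAux_popFurther]
    simp
  | cons a s ih =>
    intro l o
    have h := ih (inj a :: l) (some (inj a))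
    rw [show s.reverse.map inj ++ inj a :: l = (a :: s).reverse.map inj ++ l by simp] at h
    refine h.step ?_ (by simp)
    rw [TM2.step, preprocessedCode, stepAux_popFurther, TM2.stepAux]
    simp only [Function.update_self, List.map_cons, List.head?_cons, Option.map_some,
      Equiv.apply_symm_apply, Option.isSome_some, cond_true, stepAux_pushProgram,
      TM2.stepAux, Function.update_idem, List.tail_cons, Option.getD_some]

/-- Here `l` is what has been transferred already. The final failing pop leaves the register at
`none` and all program stacks empty; the halting configuration demands exactly this of the parts
that `M` does not control. -/
theorem preprocessed_unload (hproj : ∀ a, proj (inj a) = a) (s : List InputSymbol) :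
    ∀ (l : List (M.tm.Γ M.tm.k₀)) (o : Option Γ), StepsWithin (TM2.step mach)
      ⟨some (Sum.inr (Sum.inr 2)), (M.tm.initialState, o),
        joinStacks (Function.update (fun _ => []) M.tm.k₀ l)
          (Function.update (fun _ => []) kout (s.map inj))⟩
      ⟨some (Sum.inl M.tm.main), (M.tm.initialState, none),
        joinStacks (Function.update (fun _ => []) M.tm.k₀
          (s.reverse.map M.inputAlphabet.symm ++ l)) (fun _ => [])⟩
      (s.length + 1) := by
  induction s with
  | nil =>
    intro l o
    refine StepsWithin.single ?_ (by simp)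
    rw [TM2.step, preprocessedCode, stepAux_popProgram]
    simp
  | cons a s ih =>
    intro l o
    have h := ih (M.inputAlphabet.symm a :: l) (some (inj a))
    rw [show s.reverse.map M.inputAlphabet.symm ++ M.inputAlphabet.symm a :: l =
      (a :: s).reverse.map M.inputAlphabet.symm ++ l by simp] at h
    refine h.step ?_ (by simp)
    rw [TM2.step, preprocessedCode, stepAux_popProgram, TM2.stepAux]
    simp only [Function.update_self, List.map_cons, List.head?_cons,
      Option.isSome_some, cond_true, stepAux_pushFurther, hproj,
      TM2.stepAux, Function.update_idem, List.tail_cons, Option.getD_some]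

theorem preprocessed_steps {s out : List InputSymbol} {t : ℕ} {S : K → List Γ}
    (hS : S = Function.update (fun _ => []) kout (out.map inj))
    (h : Runs p (Function.update (fun _ => []) kin (s.reverse.map inj)) S t) :
    ∃ o, StepsWithin (TM2.step mach)
      ⟨some (Sum.inr (Sum.inr 0)), (M.tm.initialState, none),
        joinStacks (Function.update (fun _ => []) M.tm.k₀ (s.map M.inputAlphabet.symm))
          (fun _ => [])⟩
      ⟨some (Sum.inr (Sum.inr 1)), (M.tm.initialState, o),
        joinStacks (fun _ => []) (Function.update (fun _ => []) kout (out.map inj))⟩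
      (s.length + 1 + t) := by
  subst hS
  have h₁ := preprocessed_load M p kin kout inj proj s [] none
  rw [List.append_nil, Function.update_eq_self_iff.2 rfl] at h₁
  obtain ⟨o, h₂⟩ := h.stepsWithin mach (fun _ => []) M.tm.initialState
    (fun l => Sum.inr (Sum.inl l)) (Sum.inr (Sum.inr 1)) (fun _ => rfl) none
  exact ⟨o, h₁.trans h₂ le_rfl⟩

variable [Finite K] [Finite Γ]

theorem initList_preprocessed (s : List InputSymbol) :
    initList (preprocessed M p kin kout inj proj).tm
        (s.map (preprocessed M p kin kout inj proj).inputAlphabet.symm) =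
      ⟨some (Sum.inr (Sum.inr 0)), (M.tm.initialState, none),
        joinStacks (Function.update (fun _ => []) M.tm.k₀ (s.map M.inputAlphabet.symm))
          (fun _ => [])⟩ := by
  rw [Turing.initList_eq]
  refine congrArg (TM2.Cfg.mk (some (Sum.inr (Sum.inr 0) : PreprocessedLabel M p))
    (M.tm.initialState, (none : Option Γ))) ?_
  rw [← update_joinStacks_inl]
  refine congrArg₂ (fun f l => Function.update f (Sum.inl M.tm.k₀) l) ?_ rfl
  funext k
  rcases k with k | k <;> rfl

theorem haltList_preprocessed (s : List Bool) :
    haltList (preprocessed M p kin kout inj proj).tm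
        (s.map (preprocessed M p kin kout inj proj).outputAlphabet.symm) =
      ⟨none, (M.tm.initialState, none),
        joinStacks (Function.update (fun _ => []) M.tm.k₁ (s.map M.outputAlphabet.symm))
          (fun _ => [])⟩ := by
  rw [Turing.haltList_eq]
  refine congrArg (TM2.Cfg.mk (none : Option (PreprocessedLabel M p))
    (M.tm.initialState, (none : Option Γ))) ?_
  rw [← update_joinStacks_inl]
  refine congrArg₂ (fun f l => Function.update f (Sum.inl M.tm.k₁) l) ?_ rfl
  funext k
  rcases k with k | k <;> rfl

/-- If the program has no output, the machine answers no. -/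
theorem preprocessed_reject {s : List InputSymbol} {t : ℕ}
    (h : Runs p (Function.update (fun _ => []) kin (s.reverse.map inj)) (fun _ => []) t) :
    Nonempty (TM2OutputsInTime (preprocessed M p kin kout inj proj).tm
      (s.map (preprocessed M p kin kout inj proj).inputAlphabet.symm)
      (some ([false].map (preprocessed M p kin kout inj proj).outputAlphabet.symm))
      (s.length + t + 2)) := by
  obtain ⟨o, h₁⟩ := preprocessed_steps M p kin kout inj proj (out := [])
    (Function.update_eq_self_iff.2 rfl).symm h
  unfold TM2OutputsInTime
  rw [initList_preprocessed, Option.map_some, haltList_preprocessed]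
  refine h₁.trans (StepsWithin.single ?_ le_rfl) (by omega)
  rw [TM2.step, preprocessedCode, stepAux_popProgram, TM2.stepAux]
  simp [stepAux_pushFurther]
  rfl

/-- If the program has an output, the machine `M` is executed on it. -/
theorem preprocessed_execute (hproj : ∀ a, proj (inj a) = a) {s out : List InputSymbol}
    (hout : out ≠ []) {t u : ℕ} {answer : Bool}
    (h : Runs p (Function.update (fun _ => []) kin (s.reverse.map inj))
      (Function.update (fun _ => []) kout (out.reverse.map inj)) t)
    (hM : Nonempty (TM2OutputsInTime M.tm (out.map M.inputAlphabet.symm)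
      (some ([answer].map M.outputAlphabet.symm)) u)) :
    Nonempty (TM2OutputsInTime (preprocessed M p kin kout inj proj).tm
      (s.map (preprocessed M p kin kout inj proj).inputAlphabet.symm)
      (some ([answer].map (preprocessed M p kin kout inj proj).outputAlphabet.symm))
      (s.length + t + out.length + u + 2)) := by
  obtain ⟨o, h₁⟩ := preprocessed_steps M p kin kout inj proj rfl h
  -- The first pop also tests whether there is an output, so its symbol is treated separately. It is
  -- the last symbol of the output, which lies on top of `kout`.
  obtain ⟨out, a, rfl⟩ : ∃ l a, out = l ++ [a] :=
    ⟨_, _, (List.dropLast_append_getLast hout).symm⟩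
  unfold TM2OutputsInTime
  rw [initList_preprocessed, Option.map_some, haltList_preprocessed]
  have h₂ := preprocessed_unload M p kin kout inj proj hproj out.reverse
    [M.inputAlphabet.symm a] (some (inj a))
  rw [List.reverse_reverse, show out.map M.inputAlphabet.symm ++ [M.inputAlphabet.symm a] =
    (out ++ [a]).map M.inputAlphabet.symm by simp] at h₂
  have h₃ := StepsWithin.lift (m' := mach) (emb := Sum.inl) (fun l => rfl) none (fun _ => []) hM
  rw [Turing.initList_eq, Turing.haltList_eq] at h₃
  refine h₁.trans ((h₂.step ?_ le_rfl).trans h₃ le_rfl) (by simp; omega)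
  rw [TM2.step, preprocessedCode, stepAux_popProgram, TM2.stepAux]
  simp [stepAux_pushFurther, hproj]

end

end StackProgram

/-! ### A machine has to read its input -/

/-- The number of pops in a statement. -/
def Turing.TM2.Stmt.pops {K : Type} {Γ : K → Type} {Λ σ : Type} : TM2.Stmt Γ Λ σ → ℕ
  | .push _ _ q => q.pops
  | .peek _ _ q => q.pops
  | .pop _ _ q => q.pops + 1
  | .load _ q => q.pops
  | .branch _ q₁ q₂ => q₁.pops + q₂.pops
  | .goto _ => 0
  | .halt => 0

/-- Only pops shorten a stack, each by at most one symbol. Counting the pops of both sides of a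
branch is wasteful but gives a bound independent of the state. -/
theorem Turing.TM2.length_le_stepAux {K : Type} [DecidableEq K] {Γ : K → Type} {Λ σ : Type}
    (k : K) (q : TM2.Stmt Γ Λ σ) : ∀ (v : σ) (S : ∀ k, List (Γ k)),
      (S k).length ≤ ((TM2.stepAux q v S).stk k).length + q.pops := by
  induction q with
  | push j f q ih =>
    intro v S
    refine le_trans ?_ (ih _ _)
    by_cases h : k = j
    · subst h; simp
    · simp [h]
  | peek j f q ih => exact fun v S => ih _ _
  | pop j f q ih =>
    intro v S
    have := ih (f v (S j).head?) (Function.update S j (S j).tail)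
    rw [TM2.stepAux, TM2.Stmt.pops]
    by_cases h : k = j
    · subst h
      rw [Function.update_self, List.length_tail] at this
      omega
    · rw [Function.update_of_ne h] at this
      omega
  | load f q ih => exact fun v S => ih _ _
  | branch f q₁ q₂ ih₁ ih₂ =>
    intro v S
    have h₁ := ih₁ v S
    have h₂ := ih₂ v S
    rw [TM2.stepAux, TM2.Stmt.pops]
    cases f v <;> simp only [cond_true, cond_false] <;> omega
  | goto f => intro v S; simp [TM2.Stmt.pops]
  | halt => intro v S; simp [TM2.Stmt.pops]

/-- In the halting configuration nothing is left but the answer, so the whole input has been popped,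
and one step executes a bounded number of pops. -/
theorem Turing.exists_length_le_mul (tm : FinTM2) : ∃ b : ℕ,
    ∀ (s : List (tm.Γ tm.k₀)) (a : tm.Γ tm.k₁) (t : ℕ),
      Nonempty (TM2OutputsInTime tm s (some [a]) t) → s.length ≤ b * t + 1 := by
  have := tm.ΛFin
  refine ⟨∑ l : tm.Λ, (tm.m l).pops, fun s a t => ?_⟩
  set b := ∑ l : tm.Λ, (tm.m l).pops with hb
  have key : ∀ n (c c' : TM2.Cfg tm.Γ tm.Λ tm.σ),
      (flip bind (TM2.step tm.m))^[n] (some c) = some c' →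
        (c.stk tm.k₀).length ≤ (c'.stk tm.k₀).length + b * n := by
    intro n
    induction n with
    | zero =>
      intro c c' h
      obtain rfl : c = c' := by simpa using h
      simp
    | succ n ih =>
      intro c c' h
      rw [Function.iterate_succ_apply'] at h
      cases hc : (flip bind (TM2.step tm.m))^[n] (some c) with
      | none => rw [hc] at h; cases h
      | some d =>
        rw [hc] at h
        have h₁ := ih c d hc
        replace h : TM2.step tm.m d = some c' := h
        obtain ⟨l, v, S⟩ := d
        cases l with
        | none => cases h
        | some l =>
          obtain rfl : TM2.stepAux (tm.m l) v S = c' := Option.some.inj h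
          have h₂ := TM2.length_le_stepAux tm.k₀ (tm.m l) v S
          have h₃ : (tm.m l).pops ≤ b :=
            Finset.single_le_sum (f := fun l => (tm.m l).pops) (fun _ _ => Nat.zero_le _)
              (Finset.mem_univ l)
          dsimp only at h₁
          rw [Nat.mul_succ]
          omega
  rintro ⟨⟨⟨n, hn⟩, ht⟩⟩
  rw [Option.map_some, initList_eq, haltList_eq] at hn
  have h := key n _ _ hn
  simp only [Function.update_self] at h
  -- The input stack may also be the output stack, so one symbol can remain on it.
  have h₁ : ∀ k, (Function.update (fun _ => []) tm.k₁ [a] k : List (tm.Γ k)).length ≤ 1 := by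
    intro k
    by_cases e : k = tm.k₁
    · subst e; simp
    · simp [e]
  have h₂ := h₁ tm.k₀
  have := Nat.mul_le_mul_left b (show n ≤ t from ht)
  omega

/-! ### The Fitting-free group of a binary code -/

/-- The parity of a permutation of five points. -/
def parityBit (g : Equiv.Perm (Fin 5)) : ZMod 2 := if Equiv.Perm.sign g = 1 then 0 else 1

theorem parityBit_eq_zero {g : Equiv.Perm (Fin 5)} :
    parityBit g = 0 ↔ g ∈ alternatingGroup (Fin 5) := by
  rw [Equiv.Perm.mem_alternatingGroup, parityBit]
  split_ifs with h <;> simp [h]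

theorem parityBit_mul (g h : Equiv.Perm (Fin 5)) : parityBit (g * h) = parityBit g + parityBit h := by
  unfold parityBit
  simp only [map_mul]
  rcases Int.units_eq_one_or (Equiv.Perm.sign g) with h₁ | h₁ <;>
    rcases Int.units_eq_one_or (Equiv.Perm.sign h) with h₂ | h₂ <;> rw [h₁, h₂] <;> decide

theorem parityBit_one : parityBit 1 = 0 := parityBit_eq_zero.2 (one_mem _)

theorem parityBit_inv (g : Equiv.Perm (Fin 5)) : parityBit g⁻¹ = parityBit g := by
  simp [parityBit]

/-- The transposition of the first two of five points. -/
def oddPerm : Equiv.Perm (Fin 5) := Equiv.swap 0 1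

theorem parityBit_oddPerm : parityBit oddPerm = 1 := by
  rw [parityBit, if_neg]
  rw [oddPerm, Equiv.Perm.sign_swap (by decide)]
  decide

/-- A permutation of the given parity. -/
def ofParity (c : ZMod 2) : Equiv.Perm (Fin 5) := if c = 0 then 1 else oddPerm

theorem parityBit_ofParity (c : ZMod 2) : parityBit (ofParity c) = c := by
  unfold ofParity
  split_ifs with h
  · rw [h, parityBit_one]
  · rw [parityBit_oddPerm]
    revert h
    revert c
    decide

/-- The centralizer of $A_5$ in $S_5$ is trivial: if $x$ moves $i$, some 3-cycle fixes $i$ and moves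
$x(i)$, and it cannot commute with $x$. -/
theorem eq_one_of_forall_commute {x : Equiv.Perm (Fin 5)}
    (h : ∀ a ∈ alternatingGroup (Fin 5), a * x = x * a) : x = 1 := by
  have exists_points : ∀ i j : Fin 5, ∃ k l : Fin 5, i ≠ j →
      i ≠ k ∧ i ≠ l ∧ j ≠ k ∧ j ≠ l ∧ k ≠ l := by decide
  ext1 i
  by_contra hi
  replace hi : x i ≠ i := hi
  obtain ⟨k, l, hkl⟩ := exists_points i (x i)
  obtain ⟨hik, hil, hjk, hjl, hkl⟩ := hkl hi.symm
  -- This 3-cycle on $x(i),k,l$ fixes $i$ and sends $x(i)$ to $k$.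
  have ha : Equiv.swap (x i) k * Equiv.swap k l ∈ alternatingGroup (Fin 5) := by
    rw [Equiv.Perm.mem_alternatingGroup, map_mul, Equiv.Perm.sign_swap hjk,
      Equiv.Perm.sign_swap hkl]
    rfl
  have e := congrArg (fun g : Equiv.Perm (Fin 5) => g i) (h _ ha)
  simp only [Equiv.Perm.mul_apply] at e
  rw [Equiv.swap_apply_of_ne_of_ne hik hil, Equiv.swap_apply_of_ne_of_ne hjk hjl,
    Equiv.swap_apply_left, Equiv.swap_apply_of_ne_of_ne hi.symm hik] at e
  exact hjk e.symm

/-- The tuples of permutations of five points whose parities form a word of the code. -/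
def codeGroup {n : ℕ} (C : BinaryCode n) : Subgroup (Fin n → Equiv.Perm (Fin 5)) where
  carrier := {g | (fun k => parityBit (g k)) ∈ C}
  mul_mem' {g h} hg hh := by
    change (fun k => parityBit (g k * h k)) ∈ C
    simp only [parityBit_mul]
    exact C.add_mem hg hh
  one_mem' := by
    change (fun _ => parityBit 1) ∈ C
    simp only [parityBit_one]
    exact C.zero_mem
  inv_mem' {g} hg := by
    change (fun k => parityBit (g k)⁻¹) ∈ C
    simp only [parityBit_inv]
    exact hg

/-! ### Normal subgroups and isomorphisms of the groups of codes -/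

namespace codeGroup

variable {n : ℕ} {C D : BinaryCode n}

theorem mem_iff {g : Fin n → Equiv.Perm (Fin 5)} :
    g ∈ codeGroup C ↔ (fun k => parityBit (g k)) ∈ C := Iff.rfl

/-- The tuple with the even permutation `a` in position `k`. -/
def single (C : BinaryCode n) (k : Fin n) : alternatingGroup (Fin 5) →* codeGroup C :=
  ((MonoidHom.mulSingle (fun _ => Equiv.Perm (Fin 5)) k).comp (Subgroup.subtype _)).codRestrict _ <| by
    intro a
    have : (fun j => parityBit (Pi.mulSingle (M := fun _ => Equiv.Perm (Fin 5)) k a.1 j)) = 0 := by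
      funext j
      by_cases h : j = k
      · subst h
        simpa using parityBit_eq_zero.2 a.2
      · simp [h, parityBit_one]
    rw [mem_iff]
    exact this ▸ C.zero_mem

theorem single_same (k : Fin n) (a : alternatingGroup (Fin 5)) : (single C k a).1 k = a.1 :=
  Pi.mulSingle_eq_same (M := fun _ => Equiv.Perm (Fin 5)) k a.1

theorem single_ne {j k : Fin n} (h : j ≠ k) (a : alternatingGroup (Fin 5)) :
    (single C k a).1 j = 1 :=
  Pi.mulSingle_eq_of_ne (M := fun _ => Equiv.Perm (Fin 5)) h a.1

/-- The tuples with an even permutation in position `k` and trivial entries elsewhere. -/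
def factor (C : BinaryCode n) (k : Fin n) : Subgroup (codeGroup C) := (single C k).range

theorem ext_iff' {x y : codeGroup C} : x = y ↔ ∀ k, x.1 k = y.1 k := by
  rw [Subtype.ext_iff, funext_iff]

theorem mem_factor {k : Fin n} {x : codeGroup C} :
    x ∈ factor C k ↔ x.1 k ∈ alternatingGroup (Fin 5) ∧ ∀ j ≠ k, x.1 j = 1 := by
  constructor
  · rintro ⟨a, rfl⟩
    exact ⟨by rw [single_same]; exact a.2, fun j hj => single_ne hj a⟩
  · rintro ⟨h₁, h₂⟩
    refine ⟨⟨_, h₁⟩, ext_iff'.2 fun j => ?_⟩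
    by_cases h : j = k
    · subst h; rw [single_same]
    · rw [single_ne h, h₂ j h]

theorem factor_normal (k : Fin n) : (factor C k).Normal := by
  refine ⟨fun x hx g => ?_⟩
  rw [mem_factor] at hx ⊢
  refine ⟨(inferInstance : (alternatingGroup (Fin 5)).Normal).conj_mem _ hx.1 _, fun j hj => ?_⟩
  change g.1 j * x.1 j * (g.1 j)⁻¹ = 1
  rw [hx.2 j hj]
  simp

theorem exists_not_commute {x : Equiv.Perm (Fin 5)} (hx : x ≠ 1) :
    ∃ a : alternatingGroup (Fin 5), a.1 * x ≠ x * a.1 := by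
  by_contra! h
  exact hx (eq_one_of_forall_commute fun a ha => h ⟨a, ha⟩)

/-- Take $x\in N$ with $x_k\ne1$ and an even $a$ that does not commute with $x_k$. The commutator of
$a$, placed in position $k$, with $x$ is a nontrivial element of $N$ in the $k$-th factor; since
$A_5$ is simple, $N$ contains this factor. -/
theorem exists_factor_le {N : Subgroup (codeGroup C)} (hN : N.Normal) (h : N ≠ ⊥) :
    ∃ k, factor C k ≤ N := by
  obtain ⟨x, hxN, hx⟩ := N.bot_or_exists_ne_one.resolve_left h
  obtain ⟨k, hk⟩ : ∃ k, x.1 k ≠ 1 := by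
    by_contra! e
    exact hx (ext_iff'.2 e)
  refine ⟨k, ?_⟩
  obtain ⟨a, ha⟩ := exists_not_commute hk
  have hy : single C k a * x * (single C k a)⁻¹ * x⁻¹ ∈ N :=
    N.mul_mem (hN.conj_mem x hxN _) (N.inv_mem hxN)
  -- The commutator is the product of an element of the factor and a conjugate by $x$ of its
  -- inverse, and the factor is normal.
  have hyf : single C k a * x * (single C k a)⁻¹ * x⁻¹ ∈ factor C k := by
    rw [mul_assoc, mul_assoc, ← mul_assoc x]
    exact (factor C k).mul_mem ⟨a, rfl⟩
      ((factor_normal k).conj_mem _ ((factor C k).inv_mem ⟨a, rfl⟩) x)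
  obtain ⟨b, hb⟩ := hyf
  rw [← hb] at hy
  have hb1 : b ≠ 1 := by
    rintro rfl
    rw [map_one, eq_comm, mul_inv_eq_one, mul_inv_eq_iff_eq_mul] at hb
    have := ext_iff'.1 hb k
    apply ha
    rw [← single_same (C := C) k a]
    exact this
  have hs : IsSimpleGroup (alternatingGroup (Fin 5)) := alternatingGroup.isSimpleGroup (by simp)
  have hc : (N.comap (single C k)).Normal := hN.comap _
  rcases hc.eq_bot_or_eq_top with e | e
  · exact absurd (show b ∈ N.comap (single C k) from hy) (by rw [e]; simpa using hb1)
  · rintro _ ⟨c, rfl⟩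
    have : c ∈ N.comap (single C k) := e ▸ Subgroup.mem_top c
    exact this

theorem exists_alternating_ne_one : ∃ a : alternatingGroup (Fin 5), a ≠ 1 :=
  haveI : IsSimpleGroup (alternatingGroup (Fin 5)) := alternatingGroup.isSimpleGroup (by simp)
  exists_ne 1

theorem factor_injective : Function.Injective (factor C) := by
  intro j k h
  obtain ⟨a, ha⟩ := exists_alternating_ne_one
  by_contra hjk
  have : single C j a ∈ factor C k := h ▸ ⟨a, rfl⟩
  have h₁ := (mem_factor.1 this).2 j hjk
  rw [single_same] at h₁
  exact ha (Subtype.ext h₁)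

theorem factor_ne_bot (k : Fin n) : factor C k ≠ ⊥ := by
  obtain ⟨a, ha⟩ := exists_alternating_ne_one
  intro e
  have : single C k a ∈ factor C k := ⟨a, rfl⟩
  rw [e, Subgroup.mem_bot] at this
  have h₁ := ext_iff'.1 this k
  rw [single_same] at h₁
  exact ha (Subtype.ext h₁)

theorem eq_of_factor_le {j k : Fin n} (h : factor C j ≤ factor C k) : j = k := by
  obtain ⟨a, ha⟩ := exists_alternating_ne_one
  by_contra hjk
  have h₁ := (mem_factor.1 (h ⟨a, rfl⟩ : single C j a ∈ factor C k)).2 j hjk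
  rw [single_same] at h₁
  exact ha (Subtype.ext h₁)

/-- A nontrivial normal subgroup contains a copy of the nonabelian group $A_5$. -/
theorem fittingFree (C : BinaryCode n) : FittingFree (codeGroup C) := by
  intro A hA hcomm
  by_contra h
  obtain ⟨k, hk⟩ := exists_factor_le hA h
  obtain ⟨a, ha⟩ := exists_alternating_ne_one
  obtain ⟨b, hb⟩ := exists_not_commute (x := a.1) fun e => ha (Subtype.ext e)
  have := ext_iff'.1 (hcomm _ (hk ⟨b, rfl⟩) _ (hk ⟨a, rfl⟩)) k
  apply hb
  rw [← single_same (C := C) k a, ← single_same (C := C) k b]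
  exact this

/-- If $a$ and $x$ act alike on the $k$-th factor, then $a_k^{-1}x_k$ centralizes $A_5$, whence
$x_k=a_k$ is even. Given the factor, the condition on the right is purely group-theoretic, so
isomorphisms preserve it. -/
theorem parityBit_eq_zero_iff (x : codeGroup C) (k : Fin n) : parityBit (x.1 k) = 0 ↔
    ∃ a ∈ factor C k, ∀ y ∈ factor C k, a * y * a⁻¹ = x * y * x⁻¹ := by
  constructor
  · intro h
    refine ⟨_, ⟨⟨x.1 k, parityBit_eq_zero.1 h⟩, rfl⟩, fun y hy => ext_iff'.2 fun j => ?_⟩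
    by_cases e : j = k
    · subst e
      change (single C j _).1 j * y.1 j * ((single C j _).1 j)⁻¹ = _
      rw [single_same]
      rfl
    · change _ * y.1 j * _ = x.1 j * y.1 j * (x.1 j)⁻¹
      rw [(mem_factor.1 hy).2 j e]
      change (single C k _).1 j * 1 * ((single C k _).1 j)⁻¹ = _
      simp
  · rintro ⟨a, ha, h⟩
    have e : (a.1 k)⁻¹ * x.1 k = 1 := by
      refine eq_one_of_forall_commute fun b hb => ?_
      have := ext_iff'.1 (h _ ⟨⟨b, hb⟩, rfl⟩) k
      change a.1 k * (single C k _).1 k * (a.1 k)⁻¹ =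
        x.1 k * (single C k _).1 k * (x.1 k)⁻¹ at this
      rw [single_same] at this
      rw [mul_inv_eq_iff_eq_mul] at this
      calc b * ((a.1 k)⁻¹ * x.1 k) = (a.1 k)⁻¹ * (a.1 k * b) * (a.1 k)⁻¹ * x.1 k := by group
        _ = _ := by rw [this]; group
    rw [inv_mul_eq_one] at e
    rw [← e]
    exact parityBit_eq_zero.2 (mem_factor.1 ha).1

theorem exists_perm_of_mulEquiv (φ : codeGroup C ≃* codeGroup D) :
    ∃ σ : Equiv.Perm (Fin n), ∀ c, c ∈ C ↔ (fun k => c (σ k)) ∈ D := by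
  -- Stated for arbitrary codes so that it applies to the inverse isomorphism as well.
  have key : ∀ {C D : BinaryCode n} (φ : codeGroup C ≃* codeGroup D) (k : Fin n),
      ∃ j, factor D j ≤ (factor C k).map φ.toMonoidHom := by
    intro C D φ k
    refine exists_factor_le ((factor_normal k).map _ φ.surjective) ?_
    rw [Ne, Subgroup.map_eq_bot_iff_of_injective _ φ.injective]
    exact factor_ne_bot k
  have key' : ∀ k, ∃ j, (factor C k).map φ.toMonoidHom = factor D j := by
    intro k
    obtain ⟨j, hj⟩ := key φ k
    -- The preimage of the factor $j$ contains some factor $i$ and lies in the factor $k$; hence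
    -- $i=k$, and both inclusions are equalities.
    obtain ⟨i, hi⟩ := key φ.symm j
    have h₁ : factor C i ≤ factor C k := by
      intro x hx
      obtain ⟨y, hy, rfl⟩ := hi hx
      obtain ⟨z, hz, rfl⟩ := hj hy
      simpa using hz
    obtain rfl := eq_of_factor_le h₁
    refine ⟨j, le_antisymm ?_ hj⟩
    rintro _ ⟨x, hx, rfl⟩
    obtain ⟨y, hy, rfl⟩ := hi hx
    simpa using hy
  choose f hf using key'
  have hinj : Function.Injective f := by
    intro j k h
    apply factor_injective (C := C)
    apply Subgroup.map_injective (f := φ.toMonoidHom) φ.injective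
    rw [hf, hf, h]
  have hpar : ∀ (x : codeGroup C) k, parityBit ((φ x).1 (f k)) = parityBit (x.1 k) := by
    intro x k
    have h0 : parityBit ((φ x).1 (f k)) = 0 ↔ parityBit (x.1 k) = 0 := by
      rw [parityBit_eq_zero_iff, parityBit_eq_zero_iff, ← hf k]
      constructor
      · rintro ⟨_, ⟨a, ha, rfl⟩, h⟩
        refine ⟨a, ha, fun y hy => φ.injective ?_⟩
        simpa using h _ ⟨y, hy, rfl⟩
      · rintro ⟨a, ha, h⟩
        refine ⟨_, ⟨a, ha, rfl⟩, ?_⟩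
        rintro _ ⟨y, hy, rfl⟩
        simpa using congrArg φ (h y hy)
    have two : ∀ a b : ZMod 2, (a = 0 ↔ b = 0) → a = b := by decide
    exact two _ _ h0
  -- An isomorphism moves the parity in position $k$ to position $f(k)$. Every word of a code is the
  -- parity vector of a group element, so this determines the effect on codes.
  let σ := Equiv.ofBijective f (Finite.injective_iff_bijective.1 hinj)
  have hσ : ∀ k, f (σ.symm k) = k := σ.apply_symm_apply
  refine ⟨σ.symm, fun c => ⟨fun hc => ?_, fun hc => ?_⟩⟩
  · let x : codeGroup C := ⟨fun k => ofParity (c k), by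
      rw [mem_iff]
      simpa only [parityBit_ofParity] using hc⟩
    have hx := mem_iff.1 (φ x).2
    have e : (fun k => parityBit ((φ x).1 k)) = fun k => c (σ.symm k) := by
      funext k
      have := hpar x (σ.symm k)
      rwa [hσ, parityBit_ofParity] at this
    rwa [e] at hx
  · let y : codeGroup D := ⟨fun k => ofParity (c (σ.symm k)), by
      rw [mem_iff]
      simpa only [parityBit_ofParity] using hc⟩
    have hx := mem_iff.1 (φ.symm y).2
    have e : (fun k => parityBit ((φ.symm y).1 k)) = c := by
      funext k
      have := hpar (φ.symm y) k
      rw [φ.apply_symm_apply, parityBit_ofParity, show σ.symm (f k) = k from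
        σ.symm_apply_apply k] at this
      exact this.symm
    rwa [e] at hx

/-- A permutation of the coordinates that maps one code to the other. -/
def congr (σ : Equiv.Perm (Fin n)) (h : ∀ c, c ∈ C ↔ (fun k => c (σ k)) ∈ D) :
    codeGroup C ≃* codeGroup D where
  toFun x := ⟨fun k => x.1 (σ k), (h _).1 x.2⟩
  invFun y := ⟨fun k => y.1 (σ.symm k), by
    rw [mem_iff, h]
    simp only [Equiv.symm_apply_apply]
    exact y.2⟩
  left_inv x := by ext1; simp
  right_inv y := by ext1; simp
  map_mul' x y := rfl

theorem nonempty_mulEquiv_iff : Nonempty (codeGroup C ≃* codeGroup D) ↔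
    ∃ σ : Equiv.Perm (Fin n), ∀ c, c ∈ C ↔ (fun k => c (σ k)) ∈ D :=
  ⟨fun ⟨φ⟩ => exists_perm_of_mulEquiv φ, fun ⟨σ, h⟩ => ⟨congr σ h⟩⟩

end codeGroup

/-! ### Equivalence of codes as isomorphism of groups -/

section LinearCodeEquivalent

variable {d n : ℕ}

theorem mem_iff_of_isGeneratorMatrix {A : Matrix (Fin d) (Fin n) (ZMod 2)} {C : BinaryCode n}
    (h : IsGeneratorMatrix A C) (c : Fin n → ZMod 2) :
    c ∈ C ↔ ∃ x : Fin d → ZMod 2, Matrix.vecMul x A = c := by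
  rw [← h.2, Submodule.mem_span_range_iff_exists_fun]
  refine exists_congr fun x => ?_
  rw [Matrix.vecMul_eq_sum]
  rfl

theorem vecMul_permMatrix_apply (σ : Equiv.Perm (Fin n)) (c : Fin n → ZMod 2) :
    Matrix.vecMul c (σ.permMatrix (ZMod 2)) = fun k => c (σ.symm k) := by
  rw [Matrix.vecMul_permMatrix]
  rfl

theorem LinearCodeEquivalent.exists_perm {C D : BinaryCode n} (h : LinearCodeEquivalent C D) :
    ∃ σ : Equiv.Perm (Fin n), ∀ c, c ∈ C ↔ (fun k => c (σ k)) ∈ D := by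
  obtain ⟨d, A, B, hA, hB, T, σ, e⟩ := h
  refine ⟨σ.symm, fun c => ?_⟩
  rw [mem_iff_of_isGeneratorMatrix hA, mem_iff_of_isGeneratorMatrix hB, e]
  have hinj : Function.Injective fun c : Fin n → ZMod 2 => fun k => c (σ.symm k) :=
    fun c c' h => funext fun k => by simpa using congrFun h (σ k)
  constructor
  · rintro ⟨x, rfl⟩
    refine ⟨Matrix.vecMul x (T⁻¹).1, ?_⟩
    rw [← Matrix.vecMul_vecMul, ← Matrix.vecMul_vecMul, Matrix.vecMul_vecMul x, Units.inv_mul,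
      Matrix.vecMul_one, vecMul_permMatrix_apply]
  · rintro ⟨x, hx⟩
    refine ⟨Matrix.vecMul x T.1, ?_⟩
    rw [← Matrix.vecMul_vecMul, ← Matrix.vecMul_vecMul, vecMul_permMatrix_apply] at hx
    exact hinj hx

theorem finrank_of_isGeneratorMatrix {A : Matrix (Fin d) (Fin n) (ZMod 2)} {C : BinaryCode n}
    (h : IsGeneratorMatrix A C) : Module.finrank (ZMod 2) C = d := by
  rw [← h.2, finrank_span_eq_card h.1, Fintype.card_fin]

theorem LinearCodeEquivalent.dim_eq {d' : ℕ} {C D : BinaryCode n}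
    {A : Matrix (Fin d) (Fin n) (ZMod 2)} {B : Matrix (Fin d') (Fin n) (ZMod 2)}
    (hA : IsGeneratorMatrix A C) (hB : IsGeneratorMatrix B D) (h : LinearCodeEquivalent C D) :
    d = d' := by
  obtain ⟨e, A', B', hA', hB', -⟩ := h
  rw [← finrank_of_isGeneratorMatrix hA, ← finrank_of_isGeneratorMatrix hB,
    finrank_of_isGeneratorMatrix hA', finrank_of_isGeneratorMatrix hB']

/-- The definition lets both generator matrices be chosen, so $T=1$ suffices: permuting the columns
of $A$ already gives a basis of $D$. -/
theorem linearCodeEquivalent_of_perm {C D : BinaryCode n} {A : Matrix (Fin d) (Fin n) (ZMod 2)}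
    (hA : IsGeneratorMatrix A C) {σ : Equiv.Perm (Fin n)}
    (h : ∀ c, c ∈ C ↔ (fun k => c (σ k)) ∈ D) : LinearCodeEquivalent C D := by
  let B := A * Equiv.Perm.permMatrix (ZMod 2) σ.symm
  have hinj : Function.Injective (LinearMap.funLeft (ZMod 2) (ZMod 2) σ) :=
    LinearMap.funLeft_injective_of_surjective _ _ _ σ.surjective
  have hrow : B.row = LinearMap.funLeft (ZMod 2) (ZMod 2) σ ∘ A.row := by
    funext i
    change (A * Equiv.Perm.permMatrix (ZMod 2) σ.symm) i = fun k => A i (σ k)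
    rw [Matrix.mul_apply_eq_vecMul, vecMul_permMatrix_apply]
    rfl
  refine ⟨d, A, B, hA, ⟨?_, ?_⟩, 1, σ.symm, by simp [B]⟩
  · rw [hrow]
    exact hA.1.map' _ (LinearMap.ker_eq_bot.2 hinj)
  · rw [hrow, Set.range_comp, ← Submodule.map_span, hA.2]
    ext c
    constructor
    · rintro ⟨c, hc, rfl⟩
      exact (h c).1 hc
    · intro hc
      refine ⟨fun k => c (σ.symm k), (h _).2 (by simpa using hc), ?_⟩
      funext k
      simp [LinearMap.funLeft_apply]

theorem linearCodeEquivalent_iff {C D : BinaryCode n} {A : Matrix (Fin d) (Fin n) (ZMod 2)}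
    (hA : IsGeneratorMatrix A C) :
    LinearCodeEquivalent C D ↔ Nonempty (codeGroup C ≃* codeGroup D) := by
  rw [codeGroup.nonempty_mulEquiv_iff]
  exact ⟨LinearCodeEquivalent.exists_perm, fun ⟨_, h⟩ => linearCodeEquivalent_of_perm hA h⟩

end LinearCodeEquivalent

/-! ### The elements of the group of a code as words in label order -/

/-- A coordinate of a word: a permutation of five points, with a flag that distinguishes the
coordinates with respect to the generator matrix from the components of a group element. -/
abbrev Coord : Type := Bool × Equiv.Perm (Fin 5)

/-- The coordinatewise product of two words, ending with the second one. -/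
def mulWord : List Coord → List Coord → List Coord
  | _, [] => []
  | [], b :: w => b :: w
  | a :: p, b :: w => (b.1, a.2 * b.2) :: mulWord p w

theorem mulWord_nil_left (w : List Coord) : mulWord [] w = w := by cases w <;> rfl

theorem length_mulWord (p w : List Coord) : (mulWord p w).length = w.length := by
  induction w generalizing p with
  | nil => cases p <;> rfl
  | cons b w ih => cases p <;> simp [mulWord, ih]

theorem mulWord_ofFn_append {n : ℕ} (a b : Fin n → Coord) (s t : List Coord) :
    mulWord (List.ofFn a ++ s) (List.ofFn b ++ t) =
      List.ofFn (fun k => ((b k).1, (a k).2 * (b k).2)) ++ mulWord s t := by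
  induction n with
  | zero => simp
  | succ n ih => simp [List.ofFn_succ, mulWord, ih]

/-! ### Mixed-radix labels of words -/

theorem card_alternatingGroup_five : Fintype.card (alternatingGroup (Fin 5)) = 60 := by
  have h := two_mul_card_alternatingGroup (α := Fin 5)
  rw [Fintype.card_perm, Fintype.card_fin] at h
  have : Nat.factorial 5 = 120 := rfl
  omega

/-- The even permutations of five points, enumerated in some way. -/
noncomputable def alternatingEquiv : alternatingGroup (Fin 5) ≃ Fin 60 :=
  Fintype.equivFinOfCardEq card_alternatingGroup_five

/-- The even one of `g` and `oddPerm * g`. -/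
def evenPart (g : Equiv.Perm (Fin 5)) : alternatingGroup (Fin 5) :=
  ⟨ofParity (parityBit g) * g, by
    rw [← parityBit_eq_zero, parityBit_mul, parityBit_ofParity, CharTwo.add_self_eq_zero]⟩

/-- As `oddPerm` is an involution, `ofParity` is a homomorphic section of the parity. Thus
coefficients stored as permutations are added by the same multiplication that serves for components.
-/
theorem ofParity_add (a b : ZMod 2) : ofParity (a + b) = ofParity a * ofParity b := by
  fin_cases a <;> fin_cases b <;> decide

/-- The even part depends only on the right coset of the subgroup generated by `oddPerm`. Hence
multiplying by the word of a row changes the parities but not the digits of the components. -/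
theorem evenPart_ofParity_mul (c : ZMod 2) (g : Equiv.Perm (Fin 5)) :
    evenPart (ofParity c * g) = evenPart g := by
  apply Subtype.ext
  change ofParity (parityBit (ofParity c * g)) * (ofParity c * g) = ofParity (parityBit g) * g
  rw [parityBit_mul, parityBit_ofParity, add_comm, ← mul_assoc, ← ofParity_add, add_assoc,
    CharTwo.add_self_eq_zero, add_zero]

/-- The contribution of a coordinate to the label of a group element. -/
noncomputable def coordDigit (a : Coord) : ℕ :=
  if a.1 then (if a.2 = 1 then 0 else 1) else alternatingEquiv (evenPart a.2)

/-- The number of values of `coordDigit` on coordinates of the same kind. -/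
def coordRadix (a : Coord) : ℕ := if a.1 then 2 else 60

/-- The label of a group element, in mixed radix, starting with the least significant digit. -/
noncomputable def wordLabel : List Coord → ℕ
  | [] => 0
  | a :: w => coordRadix a * wordLabel w + coordDigit a

/-- The product of the radices of a word. -/
def wordWeight (w : List Coord) : ℕ := (w.map coordRadix).prod

/-- A coordinate appended at the end is the most significant digit. Extending all words by each
value of a new coordinate in turn therefore keeps the list sorted by label. -/
theorem wordLabel_append (w : List Coord) (a : Coord) :
    wordLabel (w ++ [a]) = wordWeight w * coordDigit a + wordLabel w := by
  induction w with
  | nil => simp [wordLabel, wordWeight]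
  | cons b w ih =>
    simp only [List.cons_append, wordLabel, ih, wordWeight, List.map_cons, List.prod_cons]
    ring

/-- The even permutations as coordinates of words. -/
noncomputable def evenCoords : List Coord :=
  (List.finRange 60).map fun i => (false, (alternatingEquiv.symm i).1)

/-- The words of the tuples of `n` even permutations. -/
noncomputable def evenWords : ℕ → List (List Coord)
  | 0 => [[]]
  | n + 1 => evenCoords.flatMap fun a => (evenWords n).map (· ++ [a])

/-- The word by which a row of a generator matrix acts. -/
def rowWord {n : ℕ} (r : Fin n → ZMod 2) : List Coord := List.ofFn fun k => (false, ofParity (r k))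

/-- Extending a list of words by a row of a generator matrix. -/
def extendWords (E : List (List Coord)) (r : List Coord) : List (List Coord) :=
  E.map (fun w => mulWord [] w ++ [(true, 1)]) ++ E.map (fun w => mulWord r w ++ [(true, oddPerm)])

/-- The words of the elements of the group of the code spanned by the rows `R`. -/
noncomputable def codeWords {n : ℕ} (R : List (Fin n → ZMod 2)) : List (List Coord) :=
  (R.map rowWord).foldl extendWords (evenWords n)

/-- The word with the given components and coordinates. -/
def groupWord {n : ℕ} (g : Fin n → Equiv.Perm (Fin 5)) (x : List (ZMod 2)) : List Coord :=
  List.ofFn (fun k => (false, g k)) ++ x.map fun c => (true, ofParity c)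

/-- The linear combination of the vectors in a list with the given coefficients. -/
def combination {n : ℕ} (R : List (Fin n → ZMod 2)) (x : List (ZMod 2)) : Fin n → ZMod 2 :=
  (List.zipWith (fun c r => c • r) x R).sum

theorem combination_append {n : ℕ} {R : List (Fin n → ZMod 2)} {x : List (ZMod 2)}
    (h : x.length = R.length) (r : Fin n → ZMod 2) (c : ZMod 2) :
    combination (R ++ [r]) (x ++ [c]) = combination R x + c • r := by
  simp [combination, List.zipWith_append h]

theorem combination_ofFn {d n : ℕ} (A : Matrix (Fin d) (Fin n) (ZMod 2)) (x : Fin d → ZMod 2) :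
    combination (List.ofFn A.row) (List.ofFn x) = Matrix.vecMul x A := by
  rw [Matrix.vecMul_eq_sum, ← List.sum_ofFn]
  refine congrArg List.sum ?_
  apply List.ext_getElem
  · simp only [List.length_zipWith, List.length_ofFn, min_self]
  · intro i h₁ h₂
    simp only [List.getElem_zipWith, List.getElem_ofFn]
    rfl

theorem mem_evenWords {n : ℕ} {w : List Coord} : w ∈ evenWords n ↔
    ∃ g : Fin n → Equiv.Perm (Fin 5), (∀ k, parityBit (g k) = 0) ∧ w = groupWord g [] := by
  induction n generalizing w with
  | zero => simp [evenWords, groupWord]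
  | succ n ih =>
    simp only [evenWords, evenCoords, List.mem_flatMap, List.mem_map, ih]
    constructor
    · rintro ⟨_, ⟨i, -, rfl⟩, _, ⟨g, hg, rfl⟩, rfl⟩
      refine ⟨Fin.snoc (α := fun _ => Equiv.Perm (Fin 5)) g (alternatingEquiv.symm i).1, ?_, ?_⟩
      · refine Fin.lastCases ?_ fun k => ?_
        · simpa using parityBit_eq_zero.2 (alternatingEquiv.symm i).2
        · simpa using hg k
      · simp only [groupWord, List.map_nil, List.append_nil, List.ofFn_succ', List.concat_eq_append,
          Fin.snoc_castSucc, Fin.snoc_last]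
    · rintro ⟨g, hg, rfl⟩
      refine ⟨_, ⟨alternatingEquiv ⟨g (Fin.last n), parityBit_eq_zero.1 (hg _)⟩, by simp, rfl⟩, _,
        ⟨fun k => g k.castSucc, fun k => hg _, rfl⟩, ?_⟩
      simp only [groupWord, List.map_nil, List.append_nil, List.ofFn_succ', List.concat_eq_append,
        Equiv.symm_apply_apply]

/-- The word of a row has only $n$ entries, and `mulWord` copies what lies beyond them, so the
coefficients stay unchanged. -/
theorem mulWord_rowWord {n : ℕ} (r : Fin n → ZMod 2) (g : Fin n → Equiv.Perm (Fin 5))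
    (x : List (ZMod 2)) :
    mulWord (rowWord r) (groupWord g x) = groupWord (fun k => ofParity (r k) * g k) x := by
  have := mulWord_ofFn_append (fun k => (false, ofParity (r k))) (fun k => (false, g k)) []
    (x.map fun c => (true, ofParity c))
  rwa [List.append_nil, mulWord_nil_left] at this

theorem codeWords_append {n : ℕ} (R : List (Fin n → ZMod 2)) (r : Fin n → ZMod 2) :
    codeWords (R ++ [r]) = extendWords (codeWords R) (rowWord r) := by
  simp [codeWords]

theorem groupWord_append {n : ℕ} (g : Fin n → Equiv.Perm (Fin 5)) (x : List (ZMod 2)) (c : ZMod 2) :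
    groupWord g x ++ [(true, ofParity c)] = groupWord g (x ++ [c]) := by
  simp [groupWord]

/-- The last coefficient tells in which half of the extended list a word lies. In the second half,
multiplication by the word of $r$ adds $r$ to the parity vector, and it is its own inverse. -/
theorem mem_codeWords {n : ℕ} {R : List (Fin n → ZMod 2)} {w : List Coord} : w ∈ codeWords R ↔
    ∃ (g : Fin n → Equiv.Perm (Fin 5)) (x : List (ZMod 2)), x.length = R.length ∧
      (fun k => parityBit (g k)) = combination R x ∧ w = groupWord g x := by
  induction R using List.reverseRecOn generalizing w with
  | nil =>
    rw [codeWords, List.map_nil, List.foldl_nil, mem_evenWords]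
    refine exists_congr fun g => ?_
    simp [combination, funext_iff]
  | append_singleton R r ih =>
    have h0 : ofParity 0 = 1 := rfl
    have h1 : ofParity 1 = oddPerm := rfl
    rw [codeWords_append, extendWords, List.mem_append, List.mem_map, List.mem_map]
    constructor
    · rintro (⟨w, hw, rfl⟩ | ⟨w, hw, rfl⟩)
      · obtain ⟨g, x, hx, hg, rfl⟩ := ih.1 hw
        refine ⟨g, x ++ [0], by simp [hx], ?_, ?_⟩
        · rw [combination_append hx, hg, zero_smul, add_zero]
        · rw [mulWord_nil_left, ← groupWord_append, h0]
      · obtain ⟨g, x, hx, hg, rfl⟩ := ih.1 hw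
        refine ⟨fun k => ofParity (r k) * g k, x ++ [1], by simp [hx], ?_, ?_⟩
        · rw [combination_append hx, ← hg, one_smul]
          funext k
          simp [parityBit_mul, parityBit_ofParity, add_comm]
        · rw [mulWord_rowWord, ← groupWord_append, h1]
    · rintro ⟨g, x, hx, hg, rfl⟩
      obtain ⟨x, c, rfl⟩ : ∃ y c, x = y ++ [c] := by
        refine ⟨_, _, (List.dropLast_append_getLast (l := x) ?_).symm⟩
        rintro rfl
        simp at hx
      replace hx : x.length = R.length := by simpa using hx
      rw [combination_append hx] at hg
      have hc : c = 0 ∨ c = 1 := (by decide : ∀ c : ZMod 2, c = 0 ∨ c = 1) c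
      rcases hc with rfl | rfl
      · left
        refine ⟨groupWord g x, ih.2 ⟨g, x, hx, by simpa using hg, rfl⟩, ?_⟩
        rw [mulWord_nil_left, ← groupWord_append, h0]
      · right
        refine ⟨groupWord (fun k => ofParity (r k) * g k) x, ih.2 ⟨_, x, hx, ?_, rfl⟩, ?_⟩
        · funext k
          have := congrFun hg k
          simp only [one_smul, Pi.add_apply] at this
          rw [parityBit_mul, parityBit_ofParity, this, add_comm, add_assoc,
            CharTwo.add_self_eq_zero, add_zero]
        · rw [mulWord_rowWord, ← groupWord_append, h1]
          congr 3
          funext k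
          rw [← mul_assoc, ← ofParity_add, CharTwo.add_self_eq_zero, h0, one_mul]

theorem range_mul (m n : ℕ) :
    List.range (m * n) = (List.range m).flatMap fun i => (List.range n).map (n * i + ·) := by
  induction m with
  | zero => simp
  | succ m ih =>
    rw [Nat.succ_mul, List.range_add, ih, List.range_succ, List.flatMap_append]
    simp [mul_comm]

theorem wordWeight_groupWord {n : ℕ} (g : Fin n → Equiv.Perm (Fin 5)) (x : List (ZMod 2)) :
    wordWeight (groupWord g x) = 60 ^ n * 2 ^ x.length := by
  simp [wordWeight, groupWord, coordRadix, Function.comp_def, List.map_const', List.ofFn_const]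

theorem wordLabel_groupWord_mul {n : ℕ} (r : Fin n → ZMod 2) (g : Fin n → Equiv.Perm (Fin 5))
    (x : List (ZMod 2)) :
    wordLabel (groupWord (fun k => ofParity (r k) * g k) x) = wordLabel (groupWord g x) := by
  unfold groupWord
  induction n with
  | zero => simp
  | succ n ih =>
    have := ih (fun k => r k.succ) (fun k => g k.succ)
    simp only [List.ofFn_succ, List.cons_append, wordLabel, this]
    simp [coordDigit, coordRadix, evenPart_ofParity_mul]

theorem map_wordLabel_evenWords (n : ℕ) : (evenWords n).map wordLabel = List.range (60 ^ n) := by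
  induction n with
  | zero => rfl
  | succ n ih =>
    have hd : ∀ i, coordDigit (false, (alternatingEquiv.symm i).1) = i := by
      intro i
      have : evenPart (alternatingEquiv.symm i).1 = alternatingEquiv.symm i := by
        apply Subtype.ext
        simp [evenPart, parityBit_eq_zero.2 (alternatingEquiv.symm i).2, ofParity]
      simp [coordDigit, this]
    rw [pow_succ', range_mul, evenWords, evenCoords, List.map_flatMap,
      ← List.map_coe_finRange_eq_range (n := 60), List.flatMap_map, List.flatMap_map]
    refine List.flatMap_congr fun i _ => ?_
    rw [List.map_map, ← ih, List.map_map]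
    refine List.map_congr_left fun w hw => ?_
    obtain ⟨g, -, rfl⟩ := mem_evenWords.1 hw
    simp [wordLabel_append, wordWeight_groupWord, hd]

/-- The second half of an extended list repeats the component digits of the first and has $1$ as its
new leading digit, so its labels are those of the first half shifted by the number of words. Thus
the position of a word in the list is its label. -/
theorem map_wordLabel_codeWords {n : ℕ} (R : List (Fin n → ZMod 2)) :
    (codeWords R).map wordLabel = List.range (60 ^ n * 2 ^ R.length) := by
  induction R using List.reverseRecOn with
  | nil => simpa [codeWords] using map_wordLabel_evenWords n
  | append_singleton R r ih =>
    have h1 : oddPerm ≠ 1 := by decide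
    rw [codeWords_append, extendWords, List.length_append, List.length_singleton, pow_succ,
      ← mul_assoc, mul_two, List.range_add, ← ih, List.map_append, List.map_map, List.map_map,
      List.map_map]
    congr 1
    · refine List.map_congr_left fun w _ => ?_
      simp [wordLabel_append, mulWord_nil_left, coordDigit]
    · refine List.map_congr_left fun w hw => ?_
      obtain ⟨g, x, hx, -, rfl⟩ := mem_codeWords.1 hw
      simp [wordLabel_append, mulWord_rowWord, coordDigit, wordLabel_groupWord_mul,
        wordWeight_groupWord, hx, h1]

theorem length_codeWords {n : ℕ} (R : List (Fin n → ZMod 2)) :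
    (codeWords R).length = 60 ^ n * 2 ^ R.length := by
  simpa using congrArg List.length (map_wordLabel_codeWords R)

theorem length_of_mem_codeWords {n : ℕ} {R : List (Fin n → ZMod 2)} {w : List Coord}
    (hw : w ∈ codeWords R) : w.length = n + R.length := by
  obtain ⟨g, x, hx, -, rfl⟩ := mem_codeWords.1 hw
  simp [groupWord, hx]

/-- The multiplication table, as computed from the words of the group elements. -/
noncomputable def wordTable (E : List (List Coord)) : List InputSymbol :=
  E.flatMap fun g => (E.flatMap fun h => encodeNat (wordLabel (mulWord g h)) ++ [.comma]) ++
    [.semicolon]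

theorem vecMul_injective {d n : ℕ} {A : Matrix (Fin d) (Fin n) (ZMod 2)} {C : BinaryCode n}
    (hA : IsGeneratorMatrix A C) : Function.Injective fun x => Matrix.vecMul x A := by
  rw [Matrix.vecMul_injective_iff]
  exact hA.1

/-- The elements of the group of a code can be labelled in such a way that the multiplication table
is the one computed from the words. -/
theorem exists_label {d n : ℕ} {A : Matrix (Fin d) (Fin n) (ZMod 2)} {C : BinaryCode n}
    (hA : IsGeneratorMatrix A C) : ∃ label : codeGroup C ≃ Fin (60 ^ n * 2 ^ d),
      encodeTable (cayleyTable label) = wordTable (codeWords (List.ofFn A.row)) := by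
  -- The coefficients of the parity vector in the basis formed by the rows; independence of the rows
  -- makes them unique, hence additive in $g$.
  have hx : ∀ g : codeGroup C, ∃ x, Matrix.vecMul x A = fun k => parityBit (g.1 k) := fun g =>
    (mem_iff_of_isGeneratorMatrix hA _).1 (codeGroup.mem_iff.1 g.2)
  choose x hx using hx
  let word : codeGroup C → List Coord := fun g => groupWord g.1 (List.ofFn (x g))
  have hword : ∀ w, w ∈ codeWords (List.ofFn A.row) ↔ ∃ g, w = word g := by
    intro w
    rw [mem_codeWords]
    constructor
    · rintro ⟨g, y, hy, hg, rfl⟩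
      obtain ⟨y, rfl⟩ : ∃ z : Fin d → ZMod 2, y = List.ofFn z := by
        rw [List.length_ofFn] at hy
        subst hy
        exact ⟨y.get, (List.ofFn_get y).symm⟩
      rw [combination_ofFn] at hg
      have hgC : g ∈ codeGroup C := (mem_iff_of_isGeneratorMatrix hA _).2 ⟨y, hg.symm⟩
      refine ⟨⟨g, hgC⟩, ?_⟩
      have : x ⟨g, hgC⟩ = y := vecMul_injective hA ((hx _).trans hg)
      simp [word, this]
    · rintro ⟨g, rfl⟩
      exact ⟨g.1, _, by simp, by rw [combination_ofFn, hx], rfl⟩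
  have hmul : ∀ g h, mulWord (word g) (word h) = word (g * h) := by
    intro g h
    have hxx : x (g * h) = x g + x h := by
      apply vecMul_injective hA
      dsimp only
      rw [Matrix.add_vecMul, hx, hx, hx]
      funext k
      exact parityBit_mul _ _
    have e := mulWord_ofFn_append (fun i => (true, ofParity (x g i)))
      (fun i => (true, ofParity (x h i))) [] []
    rw [List.append_nil, List.append_nil, mulWord_nil_left, List.append_nil] at e
    simp only [word, groupWord, hxx, List.map_ofFn, Function.comp_def, Pi.add_apply, ofParity_add]
    rw [mulWord_ofFn_append, e]
    rfl
  have hinj : Function.Injective word := by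
    intro g h e
    have e' := (List.append_inj e (by simp)).1
    have := List.ofFn_injective e'
    apply Subtype.ext
    funext k
    simpa using congrFun this k
  have hlabels := map_wordLabel_codeWords (List.ofFn A.row)
  rw [List.length_ofFn] at hlabels
  have hnodup : Set.InjOn wordLabel {w | w ∈ codeWords (List.ofFn A.row)} :=
    List.inj_on_of_nodup_map (hlabels ▸ List.nodup_range)
  have hlt : ∀ g, wordLabel (word g) < 60 ^ n * 2 ^ d := by
    intro g
    rw [← List.mem_range, ← hlabels]
    exact List.mem_map_of_mem ((hword _).2 ⟨g, rfl⟩)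
  let label : codeGroup C ≃ Fin (60 ^ n * 2 ^ d) :=
    Equiv.ofBijective (fun g => ⟨wordLabel (word g), hlt g⟩) <| by
      constructor
      · intro g h e
        exact hinj (hnodup ((hword _).2 ⟨g, rfl⟩) ((hword _).2 ⟨h, rfl⟩) (Fin.ext_iff.1 e))
      · intro i
        have hi : i.1 ∈ (codeWords (List.ofFn A.row)).map wordLabel := by
          rw [hlabels]
          exact List.mem_range.2 i.2
        obtain ⟨w, hw, hi⟩ := List.mem_map.1 hi
        obtain ⟨g, rfl⟩ := (hword w).1 hw
        exact ⟨g, Fin.ext hi⟩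
  have hlabel : ∀ g, (label g : ℕ) = wordLabel (word g) := fun g => rfl
  -- The $i$-th word has label $i$, so running through the list is running through the labels in
  -- order.
  have hE : codeWords (List.ofFn A.row) = (List.finRange _).map fun i => word (label.symm i) := by
    apply List.ext_getElem
    · simp [length_codeWords]
    · intro i h₁ h₂
      have hi : i < 60 ^ n * 2 ^ d := by simpa using h₂
      obtain ⟨g, hg⟩ := (hword _).1 (List.getElem_mem h₁)
      have e : wordLabel (codeWords (List.ofFn A.row))[i] = i := by
        rw [← List.getElem_map wordLabel (h := by simpa using h₁)]
        simp [hlabels]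
      rw [List.getElem_map, List.getElem_finRange, hg]
      congr 1
      rw [Equiv.eq_symm_apply]
      apply Fin.ext
      rw [hlabel, ← hg, e]
      rfl
  refine ⟨label, ?_⟩
  rw [wordTable, encodeTable, hE, List.flatMap_map]
  refine List.flatMap_congr fun i _ => ?_
  rw [List.flatMap_map]
  congr 1
  refine List.flatMap_congr fun j _ => ?_
  rw [hmul, ← hlabel]
  rfl

/-! ### Basic stack programs -/

namespace StackProgram

section

variable {K Γ : Type} [DecidableEq K]

theorem Runs.mono {p : StackProgram K Γ} {S S' : K → List Γ} {t u : ℕ} (h : Runs p S S' t)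
    (htu : t ≤ u) : Runs p S S' u := by
  cases h with
  | skip h => exact .skip (h.trans htu)
  | push h => exact .push (h.trans htu)
  | seq hp hq h => exact .seq hp hq (h.trans htu)
  | branch h hu => exact .branch h (hu.trans htu)
  | loop_nil hk h => exact .loop_nil hk (h.trans htu)
  | loop_exit hk ha h => exact .loop_exit hk ha (h.trans htu)
  | loop_cons hk ha hf hr h => exact .loop_cons hk ha hf hr (h.trans htu)

/-- A step pushes at most one symbol. This bounds the output of a program by its running time. -/
theorem Runs.length_le {p : StackProgram K Γ} {S S' : K → List Γ} {t : ℕ} (h : Runs p S S' t)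
    (k : K) : (S' k).length ≤ (S k).length + t := by
  have hu : ∀ (S : K → List Γ) (j : K) (l : List Γ), l.length ≤ (S j).length →
      (Function.update S j l k).length ≤ (S k).length := by
    intro S j l hl
    by_cases h : k = j
    · subst h; simpa using hl
    · simp [h]
  induction h with
  | skip h => omega
  | @push j a S t h =>
    by_cases h : k = j
    · subst h; simp; omega
    · simp [h]
  | seq _ _ h ihp ihq => omega
  | @branch j f S _ _ _ _ h ih =>
    have := hu S j (S j).tail (by simp)
    omega
  | loop_nil => omega
  | @loop_exit j c f S a l t hk ha h =>
    have := hu S j l (by simp [hk])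
    omega
  | @loop_cons j c f S S₁ S₂ a l s t u hk ha hf hr h ih ih' =>
    have := hu S j l (by simp [hk])
    omega

/-- Moving the contents of a stack onto another one, in reverse order. -/
def move (k j : K) : StackProgram K Γ := loop k (fun _ => true) fun a => push j a

/-- Emptying a stack. -/
def clear (k : K) : StackProgram K Γ := loop k (fun _ => true) fun _ => skip

/-- Copying the contents of the stack `k` onto the stack `j`, using the stack `i`. -/
def copy (k j i : K) : StackProgram K Γ :=
  seq (move k i) (loop i (fun _ => true) fun a => seq (push k a) (push j a))

end

end StackProgram

/-! ### The stacks of the reduction -/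

/-- The stack symbols of the reduction. -/
inductive StkSym : Type
  | inp (s : InputSymbol)
  | elt (a : Coord)
  | carry (c : Fin 60)

instance : Finite InputSymbol :=
  Finite.of_injective (β := Bool ⊕ Bool)
    (fun | .bit b => Sum.inl b | .comma => Sum.inr true | .semicolon => Sum.inr false) <| by
    rintro (_ | _ | _) (_ | _ | _) h <;> simp_all

instance : Finite StkSym :=
  Finite.of_injective (β := InputSymbol ⊕ Coord ⊕ Fin 60)
    (fun | .inp s => Sum.inl s | .elt a => Sum.inr (Sum.inl a) | .carry c => Sum.inr (Sum.inr c)) <| by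
    rintro (_ | _ | _) (_ | _ | _) h <;> simp_all

/-- The names of the stacks of the reduction. -/
inductive Stk : Type
  | input | words | wordsRest | row | rowRest | dest | outer | saved | value | valueRest | carry
  | out | countC | countD
  deriving DecidableEq

instance : Finite Stk :=
  Finite.of_injective (β := Fin 14)
    (fun
      | .input => 0 | .words => 1 | .wordsRest => 2 | .row => 3 | .rowRest => 4 | .dest => 5
      | .outer => 6 | .saved => 7 | .value => 8 | .valueRest => 9 | .carry => 10 | .out => 11
      | .countC => 12 | .countD => 13) <| by
    rintro (_ | _) (_ | _) h <;> first | rfl | exact absurd h (by decide)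

/-- The contents of the stacks of the reduction. -/
@[ext]
structure Store where
  input : List StkSym := []
  words : List StkSym := []
  wordsRest : List StkSym := []
  row : List StkSym := []
  rowRest : List StkSym := []
  dest : List StkSym := []
  outer : List StkSym := []
  saved : List StkSym := []
  value : List StkSym := []
  valueRest : List StkSym := []
  carry : List StkSym := []
  out : List StkSym := []
  countC : List StkSym := []
  countD : List StkSym := []

namespace Store

/-- The contents of a stack. -/
def get (s : Store) : Stk → List StkSym
  | .input => s.input
  | .words => s.words
  | .wordsRest => s.wordsRest
  | .row => s.row
  | .rowRest => s.rowRest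
  | .dest => s.dest
  | .outer => s.outer
  | .saved => s.saved
  | .value => s.value
  | .valueRest => s.valueRest
  | .carry => s.carry
  | .out => s.out
  | .countC => s.countC
  | .countD => s.countD

/-- Replacing the contents of a stack. -/
def set (s : Store) (k : Stk) (l : List StkSym) : Store :=
  match k with
  | .input => { s with input := l }
  | .words => { s with words := l }
  | .wordsRest => { s with wordsRest := l }
  | .row => { s with row := l }
  | .rowRest => { s with rowRest := l }
  | .dest => { s with dest := l }
  | .outer => { s with outer := l }
  | .saved => { s with saved := l }
  | .value => { s with value := l }
  | .valueRest => { s with valueRest := l }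
  | .carry => { s with carry := l }
  | .out => { s with out := l }
  | .countC => { s with countC := l }
  | .countD => { s with countD := l }

theorem update_get (s : Store) (k : Stk) (l : List StkSym) :
    Function.update s.get k l = (s.set k l).get := by
  funext j
  by_cases h : j = k
  · subst h
    rw [Function.update_self]
    cases j <;> rfl
  · rw [Function.update_of_ne h]
    cases k <;> cases j <;> first | rfl | exact absurd rfl h

theorem get_set_self (s : Store) (k : Stk) (l : List StkSym) : (s.set k l).get k = l := by
  cases k <;> rfl

theorem get_set_of_ne (s : Store) {j k : Stk} (h : j ≠ k) (l : List StkSym) :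
    (s.set k l).get j = s.get j := by
  rw [← update_get, Function.update_of_ne h]

theorem set_set (s : Store) (k : Stk) (l l' : List StkSym) : (s.set k l).set k l' = s.set k l' := by
  cases k <;> rfl

theorem set_comm (s : Store) {j k : Stk} (h : j ≠ k) (l l' : List StkSym) :
    (s.set k l).set j l' = (s.set j l').set k l := by
  cases k <;> cases j <;> first | rfl | exact absurd rfl h

theorem set_get (s : Store) (k : Stk) : s.set k (s.get k) = s := by
  cases k <;> rfl

end Store

open StackProgram

/-- The programs of the reduction. -/
abbrev StkProgram : Type := StackProgram Stk StkSym

/-- `p.Takes s s' t`: the program `p` leads from `s` to `s'` in at most `t` steps. -/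
def StackProgram.Takes (p : StkProgram) (s s' : Store) (t : ℕ) : Prop := Runs p s.get s'.get t

namespace StackProgram.Takes

variable {p q : StkProgram} {s s' s'' : Store} {t u v : ℕ}

theorem mono (h : p.Takes s s' t) (htu : t ≤ u) : p.Takes s s' u := Runs.mono h htu

theorem congr (h : p.Takes s s' t) (hs : s' = s'') (htu : t ≤ u) : p.Takes s s'' u :=
  hs ▸ h.mono htu

theorem skip (s : Store) : skip.Takes s s 1 := Runs.skip le_rfl

theorem push (k : Stk) (a : StkSym) (s : Store) : (push k a).Takes s (s.set k (a :: s.get k)) 1 := by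
  have := Runs.push (k := k) (a := a) (S := s.get) le_rfl
  rwa [Store.update_get] at this

theorem seq (hp : p.Takes s s' t) (hq : q.Takes s' s'' u) : (seq p q).Takes s s'' (t + u) :=
  Runs.seq hp hq le_rfl

theorem branch_cons {k : Stk} {f : Option StkSym → StkProgram} {a : StkSym} {l : List StkSym}
    (hk : s.get k = a :: l) (h : (f (some a)).Takes (s.set k l) s' t) :
    (branch k f).Takes s s' (t + 1) := by
  refine Runs.branch ?_ le_rfl
  rw [Store.update_get, hk]
  exact h

theorem branch_nil {k : Stk} {f : Option StkSym → StkProgram}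
    (hk : s.get k = []) (h : (f none).Takes s s' t) : (branch k f).Takes s s' (t + 1) := by
  refine Runs.branch ?_ le_rfl
  rw [Store.update_get, hk, List.tail_nil, ← hk, Store.set_get, hk]
  exact h

theorem loop_nil {k : Stk} {c : StkSym → Bool} {f : StkSym → StkProgram} (hk : s.get k = []) :
    (loop k c f).Takes s s 1 := Runs.loop_nil hk le_rfl

theorem loop_exit {k : Stk} {c : StkSym → Bool} {f : StkSym → StkProgram} {a : StkSym} {l : List StkSym}
    (hk : s.get k = a :: l) (ha : c a = false) : (loop k c f).Takes s (s.set k l) 1 := by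
  have := Runs.loop_exit (f := f) hk ha le_rfl
  rwa [Store.update_get] at this

theorem loop_cons {k : Stk} {c : StkSym → Bool} {f : StkSym → StkProgram} {a : StkSym} {l : List StkSym}
    (hk : s.get k = a :: l) (ha : c a = true) (hf : (f a).Takes (s.set k l) s' t)
    (hr : (loop k c f).Takes s' s'' u) : (loop k c f).Takes s s'' (t + u + 1) := by
  refine Runs.loop_cons hk ha ?_ hr le_rfl
  rw [Store.update_get]
  exact hf

theorem move {k j : Stk} (hjk : j ≠ k) (s : Store) : (move k j).Takes s
    ((s.set k []).set j ((s.get k).reverse ++ s.get j)) (2 * (s.get k).length + 1) := by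
  unfold StackProgram.move
  generalize hl : s.get k = l
  induction l generalizing s with
  | nil =>
    have := loop_nil (c := fun _ => true) (f := fun a => StackProgram.push j a) hl
    rw [← hl, Store.set_get]
    simpa [hl, Store.set_get] using this
  | cons a l ih =>
    have h₁ := push j a (s.set k l)
    have h₂ := ih ((s.set k l).set j (a :: (s.set k l).get j))
      (by rw [Store.get_set_of_ne _ hjk.symm, Store.get_set_self])
    refine (loop_cons hl rfl h₁ ?_).mono (t := 1 + (2 * l.length + 1) + 1) (by simp; omega)
    convert h₂ using 1
    rw [Store.set_comm _ hjk.symm, Store.set_set, Store.set_set, Store.get_set_self,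
      Store.get_set_of_ne _ hjk]
    simp

theorem clear (k : Stk) (s : Store) :
    (clear k).Takes s (s.set k []) (2 * (s.get k).length + 1) := by
  unfold StackProgram.clear
  generalize hl : s.get k = l
  induction l generalizing s with
  | nil =>
    have := loop_nil (c := fun _ => true) (f := fun _ => StackProgram.skip) hl
    rw [← hl, Store.set_get]
    simpa [hl] using this
  | cons a l ih =>
    have h₂ := ih (s.set k l) (Store.get_set_self _ _ _)
    rw [Store.set_set] at h₂
    exact (loop_cons hl rfl (skip _) h₂).mono (by simp; omega)

theorem copy {k j i : Stk} (hjk : j ≠ k) (hik : i ≠ k) (hij : i ≠ j) (s : Store)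
    (hi : s.get i = []) : (copy k j i).Takes s
    (s.set j (s.get k ++ s.get j)) (5 * (s.get k).length + 2) := by
  have key : ∀ (l : List StkSym) (s : Store), s.get i = l →
      (loop i (fun _ => true) fun a => StackProgram.seq (StackProgram.push k a)
        (StackProgram.push j a)).Takes s
        (((s.set i []).set k (l.reverse ++ s.get k)).set j (l.reverse ++ s.get j))
        (3 * l.length + 1) := by
    intro l
    induction l with
    | nil =>
      intro s hl
      have := loop_nil (c := fun _ => true) (f := fun a => StackProgram.seq (StackProgram.push k a)
        (StackProgram.push j a)) hl
      rw [← hl, Store.set_get]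
      simpa [hl, Store.set_get] using this
    | cons a l ih =>
      intro s hl
      have h₁ := push k a (s.set i l)
      have h₂ := push j a ((s.set i l).set k (a :: (s.set i l).get k))
      have h₃ := ih _ (by
        rw [Store.get_set_of_ne _ hij, Store.get_set_of_ne _ hik, Store.get_set_self] :
        (((s.set i l).set k (a :: (s.set i l).get k)).set j
          (a :: ((s.set i l).set k (a :: (s.set i l).get k)).get j)).get i = l)
      refine (loop_cons hl rfl (seq h₁ h₂) ?_).mono
        (t := (1 + 1) + (3 * l.length + 1) + 1) (by simp; omega)
      convert h₃ using 1
      simp only [Store.get_set_of_ne _ hjk, Store.get_set_of_ne _ hjk.symm,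
        Store.get_set_of_ne _ hij.symm, Store.get_set_of_ne _ hik.symm, Store.get_set_self,
        Store.set_comm _ hij, Store.set_comm _ hik, Store.set_comm _ hjk.symm, Store.set_set]
      simp
  have h₁ := move hik s
  have h₂ := key _ _ (Store.get_set_self (s.set k []) i ((s.get k).reverse ++ s.get i))
  refine (seq h₁ ?_).mono (t := 2 * (s.get k).length + 1 + (3 * (s.get k).length + 1)) (by omega)
  convert h₂ using 1
  · simp only [Store.get_set_of_ne _ hjk, Store.get_set_of_ne _ hij.symm, Store.get_set_self,
      Store.set_comm _ hik, Store.set_set, hi]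
    simp only [List.append_nil, List.reverse_reverse]
    rw [← Store.set_comm _ hik, ← hi, Store.set_get, Store.set_get]
  · simp [hi]

end StackProgram.Takes

/-! ### Binary arithmetic on stacks -/

theorem Nat.bits_of_ne_zero {c : ℕ} (h : c ≠ 0) :
    c.bits = decide (c % 2 = 1) :: (c / 2).bits := by
  have e : Nat.bit (decide (c % 2 = 1)) (c / 2) = c := by
    rw [Nat.bit_val]
    rcases Nat.mod_two_eq_zero_or_one c with h' | h' <;> simp [h'] <;> omega
  conv_lhs => rw [← e]
  refine Nat.bits_append_bit _ _ fun h0 => ?_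
  simp only [decide_eq_true_eq]
  omega

/-- The bits of `r * v + c` that are determined by the bits of `v`. -/
def mulAddBits (r : ℕ) : List Bool → ℕ → List Bool
  | [], _ => []
  | b :: l, c => decide ((r * b.toNat + c) % 2 = 1) :: mulAddBits r l ((r * b.toNat + c) / 2)

/-- The carry left after computing `mulAddBits`. -/
def mulAddCarry (r : ℕ) : List Bool → ℕ → ℕ
  | [], c => c
  | b :: l, c => mulAddCarry r l ((r * b.toNat + c) / 2)

/-- Schoolbook multiplication from the least significant bit: each step emits the parity of $rb+c$
and carries half of it, and once $v$ is exhausted the carry supplies the leading bits. -/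
theorem bits_mul_add {r : ℕ} (hr : 0 < r) (v c : ℕ) :
    mulAddBits r v.bits c ++ (mulAddCarry r v.bits c).bits = (r * v + c).bits := by
  induction v using Nat.strong_induction_on generalizing c with
  | _ v ih =>
    by_cases hv : v = 0
    · simp [hv, mulAddBits, mulAddCarry]
    · have hpos : 0 < r * v := Nat.mul_pos hr (Nat.pos_of_ne_zero hv)
      rw [Nat.bits_of_ne_zero hv, mulAddBits, mulAddCarry, List.cons_append, ih _ (by omega),
        Nat.bits_of_ne_zero (by omega : r * v + c ≠ 0)]
      have e : r * v + c = 2 * (r * (v / 2)) + (r * (decide (v % 2 = 1)).toNat + c) := by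
        have : v = 2 * (v / 2) + (decide (v % 2 = 1)).toNat := by
          rcases Nat.mod_two_eq_zero_or_one v with h' | h' <;> simp [h'] <;> omega
        calc r * v + c = r * (2 * (v / 2) + (decide (v % 2 = 1)).toNat) + c := by rw [← this]
          _ = _ := by ring
      generalize (decide (v % 2 = 1)).toNat = b at e ⊢
      generalize r * (v / 2) = x at e ⊢
      generalize r * b = y at e ⊢
      rw [e]
      congr 2
      · congr 1
        omega
      · omega

/-- Since $\lfloor(60+59)/2\rfloor=59$, the carry always fits into one of the 60 carry symbols, so
`Fin.ofNat` never wraps around. -/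
theorem mulAddCarry_lt {r : ℕ} (hr : r ≤ 60) (l : List Bool) {c : ℕ} (hc : c < 60) :
    mulAddCarry r l c < 60 := by
  induction l generalizing c with
  | nil => exact hc
  | cons b l ih =>
    refine ih ?_
    have : r * b.toNat ≤ 60 := by
      cases b <;> simp [hr]
    omega

theorem length_mulAddBits (r : ℕ) (l : List Bool) (c : ℕ) : (mulAddBits r l c).length = l.length := by
  induction l generalizing c with
  | nil => rfl
  | cons b l ih => simp [mulAddBits, ih]

theorem length_bits_le {c k : ℕ} (h : c < 2 ^ k) : c.bits.length ≤ k := by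
  rw [Nat.size_eq_bits_len]
  exact Nat.size_le.2 h

namespace StkSym

/-- A bit as a stack symbol. -/
def bit (b : Bool) : StkSym := .inp (.bit b)

/-- A carry as a stack symbol. -/
def ofCarry (c : ℕ) : StkSym := .carry (Fin.ofNat 60 c)

end StkSym

/-- Processing one bit in a multiplication by `r`. -/
def mulBit (r : ℕ) : StkSym → StkProgram
  | .inp (.bit b) => branch .carry fun
    | some (.carry c) =>
      seq (push .valueRest (.bit (decide ((r * b.toNat + c) % 2 = 1))))
        (push .carry (.ofCarry ((r * b.toNat + c) / 2)))
    | _ => skip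
  | _ => skip

/-- Whether a carry is not zero. -/
def carryNeZero : StkSym → Bool
  | .carry c => decide (c ≠ 0)
  | _ => false

/-- Processing one bit of the carry. -/
def flushBit : StkSym → StkProgram
  | .carry c => seq (push .valueRest (.bit (decide (c.1 % 2 = 1)))) (push .carry (.ofCarry (c / 2)))
  | _ => skip

/-- Replacing the number on the stack `value` by its product with the radix of a coordinate, plus the
digit of the coordinate. -/
noncomputable def hornerStep (a : Coord) : StkProgram :=
  seq (push .carry (.ofCarry (coordDigit a))) <|
    seq (loop .value (fun _ => true) (mulBit (coordRadix a))) <|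
      seq (loop .carry carryNeZero flushBit) (move .valueRest .value)

theorem mulBit_takes (r : ℕ) {c : ℕ} (hc : c < 60) (b : Bool) (s : Store)
    (hs : s.carry = [.ofCarry c]) : (mulBit r (.bit b)).Takes s
      { s with
        carry := [.ofCarry ((r * b.toNat + c) / 2)]
        valueRest := .bit (decide ((r * b.toNat + c) % 2 = 1)) :: s.valueRest } 3 := by
  have e : (Fin.ofNat 60 c).1 = c := Nat.mod_eq_of_lt hc
  refine Takes.branch_cons (k := .carry) (t := 2) hs ?_
  change (seq (push .valueRest (.bit (decide ((r * b.toNat + (Fin.ofNat 60 c).1) % 2 = 1))))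
        (push .carry (.ofCarry ((r * b.toNat + (Fin.ofNat 60 c).1) / 2)))).Takes _ _ _
  rw [e]
  exact Takes.seq (Takes.push _ _ _) (Takes.push _ _ _)

theorem mulBits_takes {r : ℕ} (hr : r ≤ 60) (l : List Bool) : ∀ {c : ℕ}, c < 60 → ∀ (s : Store),
    s.carry = [.ofCarry c] → s.value = l.map .bit →
      (loop .value (fun _ => true) (mulBit r)).Takes s
        { s with
          value := []
          carry := [.ofCarry (mulAddCarry r l c)]
          valueRest := ((mulAddBits r l c).map .bit).reverse ++ s.valueRest } (4 * l.length + 1) := by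
  induction l with
  | nil =>
    intro c hc s hs hv
    refine (Takes.loop_nil (k := .value) hv).congr ?_ le_rfl
    ext1 <;> first | rfl | assumption
  | cons b l ih =>
    intro c hc s hs hv
    have h₁ := mulBit_takes r hc b { s with value := l.map .bit } hs
    have hc' : (r * b.toNat + c) / 2 < 60 := by
      have : r * b.toNat ≤ 60 := by cases b <;> simp [hr]
      omega
    have h₂ := ih hc' { s with
      value := l.map .bit
      carry := [.ofCarry ((r * b.toNat + c) / 2)]
      valueRest := .bit (decide ((r * b.toNat + c) % 2 = 1)) :: s.valueRest } rfl rfl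
    refine (Takes.loop_cons (k := .value) hv rfl h₁ ?_).mono
      (t := 3 + (4 * l.length + 1) + 1) (by simp; omega)
    refine h₂.congr ?_ le_rfl
    ext1 <;> first | rfl | simp [mulAddBits]

/-- The loop ends on popping a zero carry; that symbol is consumed, so the stack `carry` is left
empty. -/
theorem flush_takes (c : ℕ) : c < 60 → ∀ (s : Store), s.carry = [.ofCarry c] →
    (loop .carry carryNeZero flushBit).Takes s
      { s with
        carry := []
        valueRest := (c.bits.map .bit).reverse ++ s.valueRest } (3 * c.bits.length + 1) := by
  induction c using Nat.strong_induction_on with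
  | _ c ih =>
    intro hc s hs
    have e : (Fin.ofNat 60 c).1 = c := Nat.mod_eq_of_lt hc
    by_cases h0 : c = 0
    · subst h0
      exact Takes.loop_exit (k := .carry) hs rfl
    · have h₁ : (flushBit (.ofCarry c)).Takes { s with carry := [] } { s with
          carry := [.ofCarry (c / 2)]
          valueRest := .bit (decide (c % 2 = 1)) :: s.valueRest } 2 := by
        change (seq (push .valueRest (.bit (decide ((Fin.ofNat 60 c).1 % 2 = 1))))
          (push .carry (.ofCarry ((Fin.ofNat 60 c).1 / 2)))).Takes _ _ _
        rw [e]
        exact Takes.seq (Takes.push _ _ _) (Takes.push _ _ _)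
      have h₂ := ih (c / 2) (by omega) (by omega) { s with
        carry := [.ofCarry (c / 2)]
        valueRest := .bit (decide (c % 2 = 1)) :: s.valueRest } rfl
      rw [Nat.bits_of_ne_zero h0]
      refine (Takes.loop_cons (k := .carry) hs ?_ h₁ ?_).mono
        (t := 2 + (3 * (c / 2).bits.length + 1) + 1) (by simp; omega)
      · refine decide_eq_true fun h => h0 ?_
        rw [← e]
        exact congrArg Fin.val h
      · refine h₂.congr ?_ le_rfl
        ext1 <;> first | rfl | simp

theorem coordRadix_pos (a : Coord) : 0 < coordRadix a := by
  unfold coordRadix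
  split_ifs <;> omega

theorem coordRadix_le (a : Coord) : coordRadix a ≤ 60 := by
  unfold coordRadix
  split_ifs <;> omega

theorem coordDigit_lt (a : Coord) : coordDigit a < coordRadix a := by
  unfold coordDigit coordRadix
  split_ifs
  · omega
  · omega
  · exact (alternatingEquiv (evenPart a.2)).2

/-- A radix is at most $60<2^6$, so six bits per coordinate suffice. -/
theorem wordLabel_lt (w : List Coord) : wordLabel w < 2 ^ (6 * w.length) := by
  induction w with
  | nil => simp [wordLabel]
  | cons a w ih =>
    rw [wordLabel, List.length_cons, Nat.mul_succ, pow_add]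
    have h₁ := coordDigit_lt a
    have h₂ := coordRadix_le a
    have h₃ : coordRadix a * (wordLabel w + 1) ≤ 60 * (2 ^ (6 * w.length)) :=
      Nat.mul_le_mul h₂ ih
    rw [Nat.mul_succ] at h₃
    have : 0 < 2 ^ (6 * w.length) := by positivity
    omega

theorem hornerStep_takes (a : Coord) (w : List Coord) (s : Store) (hc : s.carry = [])
    (hr : s.valueRest = []) (hv : s.value = (wordLabel w).bits.map .bit) :
    (hornerStep a).Takes s { s with value := (wordLabel (a :: w)).bits.map .bit }
      (36 * w.length + 34) := by
  have hlt : coordDigit a < 60 := (coordDigit_lt a).trans_le (coordRadix_le a)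
  have h₁ : (push .carry (.ofCarry (coordDigit a))).Takes s
      { s with carry := [.ofCarry (coordDigit a)] } 1 := by
    have := Takes.push .carry (.ofCarry (coordDigit a)) s
    rw [show s.get .carry = [] from hc] at this
    exact this
  have h₂ := mulBits_takes (coordRadix_le a) (wordLabel w).bits hlt
    { s with carry := [.ofCarry (coordDigit a)] } rfl hv
  have h₃ := flush_takes _ (mulAddCarry_lt (coordRadix_le a) (wordLabel w).bits hlt) { s with
    value := []
    carry := [.ofCarry (mulAddCarry (coordRadix a) (wordLabel w).bits (coordDigit a))]
    valueRest := ((mulAddBits (coordRadix a) (wordLabel w).bits (coordDigit a)).map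
      .bit).reverse ++ s.valueRest } rfl
  have h₄ := Takes.move (k := .valueRest) (j := .value) (by decide) { s with
    value := []
    carry := []
    valueRest := ((mulAddCarry (coordRadix a) (wordLabel w).bits (coordDigit a)).bits.map
      .bit).reverse ++ (((mulAddBits (coordRadix a) (wordLabel w).bits (coordDigit a)).map
        .bit).reverse ++ s.valueRest) }
  have hb := bits_mul_add (coordRadix_pos a) (wordLabel w) (coordDigit a)
  have hl₁ : (wordLabel w).bits.length ≤ 6 * w.length := length_bits_le (wordLabel_lt w)
  have hl₂ : (mulAddCarry (coordRadix a) (wordLabel w).bits (coordDigit a)).bits.length ≤ 6 :=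
    length_bits_le ((mulAddCarry_lt (coordRadix_le a) (wordLabel w).bits hlt).trans (by norm_num))
  refine (Takes.seq h₁ (Takes.seq h₂ (Takes.seq h₃ h₄))).congr ?_ ?_
  · ext1 <;> first | rfl | simp [Store.set, Store.get, wordLabel, ← hb, hr, hc]
  · simp only [Store.get, List.length_append, List.length_reverse, List.length_map, hr,
      length_mulAddBits, List.length_nil]
    omega

/-- Replacing a word on the stack `dest` by its label on the stack `out`. -/
noncomputable def writeLabel : StkProgram :=
  seq (loop .dest (fun _ => true) fun | .elt a => hornerStep a | _ => skip) <|
    seq (move .value .out) (push .out (.inp .comma))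

/-- The stack `dest` carries a word with its last coordinate, the most significant digit, on top,
which is the order needed for Horner's rule. Here `w` is the part already evaluated. -/
theorem horner_takes (v : List Coord) : ∀ (w : List Coord) (s : Store), s.carry = [] →
    s.valueRest = [] → s.value = (wordLabel w).bits.map .bit → s.dest = v.map .elt →
    (loop .dest (fun _ => true) fun | .elt a => hornerStep a | _ => skip).Takes s
      { s with dest := [], value := (wordLabel (v.reverse ++ w)).bits.map .bit }
      (v.length * (36 * (v.length + w.length) + 35) + 1) := by
  induction v with
  | nil =>
    intro w s _ _ hv hd
    refine (Takes.loop_nil (k := .dest) hd).congr ?_ (by simp)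
    ext1 <;> first | rfl | assumption
  | cons a v ih =>
    intro w s hc hr hv hd
    have h₁ := hornerStep_takes a w { s with dest := v.map .elt } hc hr hv
    have h₂ := ih (a :: w) { s with
      dest := v.map .elt
      value := (wordLabel (a :: w)).bits.map .bit } hc hr rfl rfl
    refine (Takes.loop_cons (k := .dest) hd rfl h₁ ?_).mono (t := 36 * w.length + 34 +
      (v.length * (36 * (v.length + (a :: w).length) + 35) + 1) + 1) ?_
    · refine h₂.congr ?_ le_rfl
      ext1 <;> first | rfl | simp
    · simp only [List.length_cons]
      nlinarith

theorem writeLabel_takes (w : List Coord) (s : Store) (hc : s.carry = []) (hr : s.valueRest = [])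
    (hv : s.value = []) (hd : s.dest = (w.map .elt).reverse) :
    writeLabel.Takes s { s with
        dest := []
        out := ((encodeNat (wordLabel w) ++ [InputSymbol.comma]).map StkSym.inp).reverse ++ s.out }
      (w.length * (36 * w.length + 35) + 12 * w.length + 3) := by
  have h₁ := horner_takes w.reverse [] s hc hr (by simpa [wordLabel] using hv) (by simpa using hd)
  rw [List.reverse_reverse, List.append_nil, List.length_reverse] at h₁
  have h₂ := Takes.move (k := .value) (j := .out) (by decide)
    { s with dest := [], value := (wordLabel w).bits.map .bit }
  have h₃ := Takes.push .out (.inp .comma) { s with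
    dest := [], value := [], out := ((wordLabel w).bits.map .bit).reverse ++ s.out }
  have hl : (wordLabel w).bits.length ≤ 6 * w.length := length_bits_le (wordLabel_lt w)
  refine (Takes.seq h₁ (Takes.seq h₂ h₃)).congr ?_ ?_
  · ext1 <;> first | rfl | simp [encodeNat, Store.set, Store.get, hv, StkSym.bit, Function.comp_def]
  · simp only [Store.get, List.length_map, List.length_nil, Nat.add_zero]
    omega

/-! ### Processing lists of words -/

/-- Words on a stack, each followed by a comma. -/
def encodeWords (E : List (List Coord)) : List StkSym :=
  E.flatMap fun w => w.map .elt ++ [.inp .comma]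

theorem length_encodeWords_le {E : List (List Coord)} {m : ℕ} (hm : ∀ w ∈ E, w.length ≤ m) :
    (encodeWords E).length ≤ E.length * (m + 1) := by
  induction E with
  | nil => simp [encodeWords]
  | cons w E ih =>
    have h₁ := hm w (by simp)
    have h₂ := ih fun v hv => hm v (by simp [hv])
    simp only [encodeWords, List.flatMap_cons, List.length_append, List.length_map,
      List.length_cons, List.length_nil] at h₂ ⊢
    rw [Nat.succ_mul]
    omega

/-- Processing one symbol of a list of words: a coordinate is multiplied by the next coordinate on
the stack `row`, and at the end of a word the program `onEnd` is executed. -/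
def mapSymbol (onEnd : StkProgram) (a : StkSym) : StkProgram :=
  seq (push .wordsRest a) <|
    match a with
    | .elt b => branch .row fun
      | some (.elt a) => seq (push .rowRest (.elt a)) (push .dest (.elt (b.1, a.2 * b.2)))
      | _ => push .dest (.elt b)
    | _ => seq onEnd (move .rowRest .row)

/-- Writing the products of the word on `row` and the words on `words` to `dest`, and executing the
program `onEnd` after each of them. -/
def mapWords (onEnd : StkProgram) : StkProgram :=
  seq (loop .words (fun _ => true) (mapSymbol onEnd)) (move .wordsRest .words)

/-- In continuation form: a run of the loop from the state after the coordinates of a word yields a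
run from the state before them. When `row` is exhausted, coordinates are copied, as in `mulWord`. -/
theorem mapSymbols_takes {onEnd : StkProgram} (w : List Coord) :
    ∀ (p q : List Coord) (l : List StkSym) (s s' : Store) (t : ℕ),
      s.words = w.map .elt ++ l → s.row = p.map .elt → s.rowRest = q.map .elt →
      (loop .words (fun _ => true) (mapSymbol onEnd)).Takes { s with
          words := l
          wordsRest := (w.map .elt).reverse ++ s.wordsRest
          row := (p.drop w.length).map .elt
          rowRest := ((p.take w.length).reverse ++ q).map .elt
          dest := ((mulWord p w).map .elt).reverse ++ s.dest } s' t →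
      (loop .words (fun _ => true) (mapSymbol onEnd)).Takes s s' (5 * w.length + t) := by
  induction w with
  | nil =>
    intro p q l s s' t hw hr hq h
    have e : s = { s with
        words := l
        wordsRest := (([] : List Coord).map .elt).reverse ++ s.wordsRest
        row := (p.drop ([] : List Coord).length).map .elt
        rowRest := ((p.take ([] : List Coord).length).reverse ++ q).map .elt
        dest := ((mulWord p []).map .elt).reverse ++ s.dest } := by
      ext1 <;> first | rfl | simp [*, mulWord]
    rw [e]
    exact h.mono (by simp)
  | cons b w ih =>
    intro p q l s s' t hw hr hq h
    cases p with
    | nil =>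
      have h₁ : (mapSymbol onEnd (.elt b)).Takes (s.set .words (w.map .elt ++ l)) { s with
          words := w.map .elt ++ l
          wordsRest := .elt b :: s.wordsRest
          dest := .elt b :: s.dest } 3 := by
        refine Takes.seq (u := 1 + 1) (Takes.push _ _ _) ?_
        exact Takes.branch_nil (k := .row) hr (Takes.push _ _ _)
      refine (Takes.loop_cons (k := .words) hw rfl h₁
        (ih [] q l _ s' t rfl hr hq ?_)).mono (by simp only [List.length_cons]; omega)
      convert h using 1
      ext1 <;> first | rfl | simp [mulWord, mulWord_nil_left]
    | cons a p =>
      have h₁ : (mapSymbol onEnd (.elt b)).Takes (s.set .words (w.map .elt ++ l)) { s with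
          words := w.map .elt ++ l
          wordsRest := .elt b :: s.wordsRest
          row := p.map .elt
          rowRest := .elt a :: s.rowRest
          dest := .elt (b.1, a.2 * b.2) :: s.dest } 4 := by
        refine Takes.seq (u := 1 + 1 + 1) (Takes.push _ _ _) ?_
        exact Takes.branch_cons (k := .row) hr (Takes.seq (Takes.push _ _ _) (Takes.push _ _ _))
      refine (Takes.loop_cons (k := .words) hw rfl h₁
        (ih p (a :: q) l _ s' t rfl rfl (by simp [hq]) ?_)).mono
          (by simp only [List.length_cons]; omega)
      convert h using 1
      ext1 <;> first | rfl | simp [mulWord]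

/-- The effect of a program that is executed at the ends of words: at the end of the word `w`, with
the product of `p` and `w` on `dest`, the program replaces this product by `d w` and writes `o w` to
`out`. -/
def EndEffect (onEnd : StkProgram) (p : List Coord) (E : List (List Coord))
    (C : List StkSym → Prop) (d o : List Coord → List StkSym) (t : ℕ) : Prop :=
  ∀ w ∈ E, ∀ s : Store, C s.dest → s.value = [] → s.valueRest = [] → s.carry = [] →
    C ((d w).reverse ++ s.dest) ∧
      onEnd.Takes { s with dest := ((mulWord p w).map .elt).reverse ++ s.dest }
        { s with dest := (d w).reverse ++ s.dest, out := (o w).reverse ++ s.out } t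

/-- After each word the used part of `row` is moved back from `rowRest`, so every word meets the
same left factor. The condition `C` on `dest` is the invariant that `onEnd` may rely on. -/
theorem mapLoop_takes {onEnd : StkProgram} {p : List Coord} {C : List StkSym → Prop}
    {d o : List Coord → List StkSym} {t m : ℕ} (E : List (List Coord)) :
    ∀ (_ : EndEffect onEnd p E C d o t) (_ : ∀ w ∈ E, w.length ≤ m) (s : Store),
      s.words = encodeWords E → s.row = p.map .elt → s.rowRest = [] → C s.dest → s.value = [] →
      s.valueRest = [] → s.carry = [] →
      (loop .words (fun _ => true) (mapSymbol onEnd)).Takes s { s with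
        words := []
        wordsRest := (encodeWords E).reverse ++ s.wordsRest
        dest := (E.flatMap d).reverse ++ s.dest
        out := (E.flatMap o).reverse ++ s.out } (E.length * (7 * m + t + 3) + 1) := by
  induction E with
  | nil =>
    intro hE hm s hw hr hq hC hv hvr hc
    refine (Takes.loop_nil (k := .words) hw).congr ?_ (by simp)
    ext1 <;> first | rfl | exact hw
  | cons w E ih =>
    intro hE hm s hw hr hq hC hv hvr hc
    obtain ⟨hC', h₁⟩ := hE w (by simp) { s with
      words := encodeWords E
      wordsRest := .inp .comma :: (w.map .elt).reverse ++ s.wordsRest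
      row := (p.drop w.length).map .elt
      rowRest := ((p.take w.length).reverse ++ []).map .elt } hC hv hvr hc
    have hwm := hm w (by simp)
    have h₂ := Takes.move (k := .rowRest) (j := .row) (by decide) { s with
      words := encodeWords E
      wordsRest := .inp .comma :: (w.map .elt).reverse ++ s.wordsRest
      row := (p.drop w.length).map .elt
      rowRest := ((p.take w.length).reverse ++ []).map .elt
      dest := (d w).reverse ++ s.dest
      out := (o w).reverse ++ s.out }
    have h₃ := ih (fun v hv => hE v (by simp [hv])) (fun v hv => hm v (by simp [hv])) { s with
      words := encodeWords E
      wordsRest := .inp .comma :: (w.map .elt).reverse ++ s.wordsRest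
      dest := (d w).reverse ++ s.dest
      out := (o w).reverse ++ s.out } rfl hr hq hC' hv hvr hc
    have h₄ : (mapSymbol onEnd (.inp .comma)).Takes { s with
        words := encodeWords E
        wordsRest := (w.map .elt).reverse ++ s.wordsRest
        row := (p.drop w.length).map .elt
        rowRest := ((p.take w.length).reverse ++ []).map .elt
        dest := ((mulWord p w).map .elt).reverse ++ s.dest } { s with
        words := encodeWords E
        wordsRest := .inp .comma :: (w.map .elt).reverse ++ s.wordsRest
        dest := (d w).reverse ++ s.dest
        out := (o w).reverse ++ s.out } (2 * m + t + 2) := by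
      refine (Takes.seq (Takes.push _ _ _) (Takes.seq h₁ h₂)).congr ?_ ?_
      · ext1 <;> first | rfl | simp [Store.get, Store.set, hr, hq]
      · simp only [Store.get, List.length_map, List.append_nil, List.length_reverse,
          List.length_take]
        omega
    refine (mapSymbols_takes w p [] (.inp .comma :: encodeWords E) s _ _
      (by simp [hw, encodeWords]) hr hq (Takes.loop_cons (k := .words) rfl rfl h₄ h₃)).congr ?_ ?_
    · ext1 <;> first | rfl | simp [encodeWords]
    · rw [List.length_cons, Nat.add_one_mul E.length]
      omega

theorem mapWords_takes {onEnd : StkProgram} {p : List Coord} {C : List StkSym → Prop}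
    {d o : List Coord → List StkSym} {t m : ℕ} {E : List (List Coord)}
    (hE : EndEffect onEnd p E C d o t) (hm : ∀ w ∈ E, w.length ≤ m) {s : Store}
    (hw : s.words = encodeWords E) (hr : s.row = p.map .elt) (hq : s.rowRest = [])
    (hC : C s.dest) (hv : s.value = []) (hvr : s.valueRest = []) (hc : s.carry = [])
    (hwr : s.wordsRest = []) :
    (mapWords onEnd).Takes s { s with
      dest := (E.flatMap d).reverse ++ s.dest
      out := (E.flatMap o).reverse ++ s.out } (E.length * (9 * m + t + 5) + 2) := by
  have h₁ := mapLoop_takes E hE hm s hw hr hq hC hv hvr hc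
  refine (Takes.seq h₁ (Takes.move (by decide) _)).congr ?_ ?_
  · ext1 <;> first | rfl | simp [Store.get, Store.set, hwr, hw]
  · have := length_encodeWords_le hm
    simp only [Store.get, hwr, List.append_nil, List.length_reverse]
    calc _ ≤ E.length * (7 * m + t + 3) + 1 + (2 * (E.length * (m + 1)) + 1) := by omega
      _ = _ := by ring

/-- Appending a coordinate to a word. -/
def appendCoord (a : Coord) : StkProgram := seq (push .dest (.elt a)) (push .dest (.inp .comma))

theorem mapWords_appendCoord_takes (a : Coord) {p : List Coord} {m : ℕ} {E : List (List Coord)}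
    (hm : ∀ w ∈ E, w.length ≤ m) {s : Store}
    (hw : s.words = encodeWords E) (hr : s.row = p.map .elt) (hq : s.rowRest = [])
    (hv : s.value = []) (hvr : s.valueRest = []) (hc : s.carry = []) (hwr : s.wordsRest = []) :
    (mapWords (appendCoord a)).Takes s { s with
      dest := (encodeWords (E.map fun w => mulWord p w ++ [a])).reverse ++ s.dest }
      (E.length * (9 * m + 7) + 2) := by
  -- Results accumulate on `dest`, so nothing is required of its contents.
  have hE : EndEffect (appendCoord a) p E (fun _ => True)
      (fun w => (mulWord p w ++ [a]).map .elt ++ [.inp .comma]) (fun _ => []) 2 := by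
    intro w hw s _ _ _ _
    refine ⟨trivial, (Takes.seq (Takes.push _ _ _) (Takes.push _ _ _)).congr ?_ le_rfl⟩
    ext1 <;> first | rfl | simp [Store.get, Store.set]
  refine (mapWords_takes hE hm hw hr hq trivial hv hvr hc hwr).congr ?_ le_rfl
  ext1 <;> first | rfl | simp [encodeWords, List.flatMap_map]

theorem mapWords_writeLabel_takes {p : List Coord} {m : ℕ} {E : List (List Coord)}
    (hm : ∀ w ∈ E, w.length ≤ m) {s : Store}
    (hw : s.words = encodeWords E) (hr : s.row = p.map .elt) (hq : s.rowRest = [])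
    (hv : s.value = []) (hvr : s.valueRest = []) (hc : s.carry = []) (hwr : s.wordsRest = [])
    (hd : s.dest = []) :
    (mapWords writeLabel).Takes s { s with
      out := ((E.flatMap fun w => encodeNat (wordLabel (mulWord p w)) ++ [InputSymbol.comma]).map
        StkSym.inp).reverse ++ s.out }
      (E.length * (9 * m + (m * (36 * m + 35) + 12 * m + 3) + 5) + 2) := by
  -- `writeLabel` consumes the whole stack `dest`, which must therefore hold nothing but the current
  -- product.
  have hE : EndEffect writeLabel p E (fun l => l = []) (fun _ => [])
      (fun w => (encodeNat (wordLabel (mulWord p w)) ++ [InputSymbol.comma]).map StkSym.inp)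
      (m * (36 * m + 35) + 12 * m + 3) := by
    intro w hw s hd hv hvr hc
    refine ⟨hd, (writeLabel_takes (mulWord p w)
      { s with dest := ((mulWord p w).map .elt).reverse ++ s.dest } hc hvr hv (by simp [hd])).congr ?_ ?_⟩
    · ext1 <;> first | rfl | simp [hd]
    · have := hm w hw
      rw [length_mulWord]
      gcongr
  refine (mapWords_takes hE hm hw hr hq hd hv hvr hc hwr).congr ?_ le_rfl
  ext1 <;> first | rfl | simp [List.map_flatMap]

/-! ### The reduction as a stack program -/

/-- All stacks are empty that are used while a list of words is processed. -/
structure Store.Idle (s : Store) : Prop where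
  wordsRest : s.wordsRest = []
  row : s.row = []
  rowRest : s.rowRest = []
  dest : s.dest = []
  value : s.value = []
  valueRest : s.valueRest = []
  carry : s.carry = []

/-- Replacing the list of words on `words` by the one collected on `dest`. -/
def replaceWords : StkProgram := seq (clear .words) (move .dest .words)

theorem replaceWords_takes {E F : List (List Coord)} {B m : ℕ} (hE : E.length ≤ B)
    (hF : F.length ≤ B) (hmE : ∀ w ∈ E, w.length ≤ m) (hmF : ∀ w ∈ F, w.length ≤ m) {s : Store}
    (hw : s.words = encodeWords E) (hd : s.dest = (encodeWords F).reverse) :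
    replaceWords.Takes s { s with words := encodeWords F, dest := [] } (4 * (B * (m + 1)) + 2) := by
  refine (Takes.seq (Takes.clear _ _) (Takes.move (by decide) _)).congr ?_ ?_
  · ext1 <;> first | rfl | simp [Store.get, Store.set, hd]
  · have h₁ := (length_encodeWords_le hmE).trans (Nat.mul_le_mul_right (m + 1) hE)
    have h₂ := (length_encodeWords_le hmF).trans (Nat.mul_le_mul_right (m + 1) hF)
    simp only [Store.get, Store.set, hw, hd, List.length_reverse]
    omega

/-- Writing the words extended by the coordinates in a list to `dest`. -/
def appendCoords : List Coord → StkProgram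
  | [] => skip
  | a :: l => seq (mapWords (appendCoord a)) (appendCoords l)

theorem appendCoords_takes {E : List (List Coord)} {B m : ℕ} (hE : E.length ≤ B)
    (hm : ∀ w ∈ E, w.length ≤ m) (l : List Coord) : ∀ (s : Store), s.words = encodeWords E →
    s.row = [] → s.rowRest = [] → s.value = [] → s.valueRest = [] → s.carry = [] →
    s.wordsRest = [] → (appendCoords l).Takes s { s with
      dest := (encodeWords (l.flatMap fun a => E.map (· ++ [a]))).reverse ++ s.dest }
      (l.length * (B * (9 * m + 7) + 2) + 1) := by
  induction l with
  | nil =>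
    intro s _ _ _ _ _ _ _
    exact (Takes.skip s).congr (by ext1 <;> rfl) (by simp)
  | cons a l ih =>
    intro s hw hr hq hv hvr hc hwr
    have h₁ := mapWords_appendCoord_takes a (p := []) hm hw hr hq hv hvr hc hwr
    refine (Takes.seq h₁ (ih _ hw hr hq hv hvr hc hwr)).congr ?_ ?_
    · ext1 <;> first | rfl | simp [encodeWords, mulWord_nil_left]
    · have := Nat.mul_le_mul_right (9 * m + 7) hE
      rw [List.length_cons, Nat.add_one_mul l.length]
      omega

/-- Extending all words by all even permutations. -/
noncomputable def evenStep : StkProgram := seq (appendCoords evenCoords) replaceWords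

/-- A bound for the time of `evenStep`. -/
def evenStepTime (B m : ℕ) : ℕ := 60 * (B * (9 * m + 7) + 2) + 1 + (4 * (B * (m + 1)) + 2)

theorem length_evenWords (n : ℕ) : (evenWords n).length = 60 ^ n := by
  simpa using congrArg List.length (map_wordLabel_evenWords n)

theorem length_of_mem_evenWords {n : ℕ} {w : List Coord} (hw : w ∈ evenWords n) : w.length = n := by
  obtain ⟨g, -, rfl⟩ := mem_evenWords.1 hw
  simp [groupWord]

theorem evenStep_takes {k B m : ℕ} (hB : 60 ^ (k + 1) ≤ B) (hm : k + 1 ≤ m) {s : Store}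
    (hs : s.Idle) (hw : s.words = encodeWords (evenWords k)) :
    evenStep.Takes s { s with words := encodeWords (evenWords (k + 1)) } (evenStepTime B m) := by
  have hB' : 60 ^ k ≤ B := le_trans (Nat.pow_le_pow_right (by norm_num) (by omega)) hB
  have h₁ := appendCoords_takes (B := B) (m := m) (by rw [length_evenWords]; exact hB')
    (fun w hw => (length_of_mem_evenWords hw).trans_le (by omega)) evenCoords s hw hs.row hs.rowRest
    hs.value hs.valueRest hs.carry hs.wordsRest
  rw [show evenCoords.length = 60 by simp [evenCoords]] at h₁
  refine (Takes.seq h₁ (replaceWords_takes (E := evenWords k) (F := evenWords (k + 1)) (B := B)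
    (m := m) (by rw [length_evenWords]; exact hB') (by rw [length_evenWords]; exact hB)
    (fun w hw => (length_of_mem_evenWords hw).trans_le (by omega))
    (fun w hw => (length_of_mem_evenWords hw).trans_le (by omega)) hw ?_)).congr ?_ le_rfl
  · simp [hs.dest, evenWords]
  · ext1 <;> first | rfl | exact hs.dest.symm

/-- Whether a symbol is not a semicolon. -/
def neSemicolon : StkSym → Bool
  | .inp .semicolon => false
  | _ => true

/-- After $k$ rounds, $j$ marks of the unary length remain. The bounds $B$ and $m$ refer to the
final list, so one time bound serves all rounds. -/
theorem evenSteps_takes {B m : ℕ} (l : List StkSym) (j : ℕ) : ∀ (k : ℕ), 60 ^ (k + j) ≤ B →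
    k + j ≤ m → ∀ (s : Store), s.Idle → s.words = encodeWords (evenWords k) →
    s.input = List.replicate j (.inp (.bit true)) ++ .inp .semicolon :: l →
    (loop .input neSemicolon fun _ => evenStep).Takes s
      { s with input := l, words := encodeWords (evenWords (k + j)) }
      (j * (evenStepTime B m + 1) + 1) := by
  induction j with
  | zero =>
    intro k _ _ s _ hw hi
    refine (Takes.loop_exit (k := .input) hi rfl).congr ?_ (by simp)
    ext1 <;> first | rfl | exact hw
  | succ j ih =>
    intro k hB hm s hs hw hi
    have e : k + (j + 1) = k + 1 + j := by omega
    rw [e] at hB hm ⊢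
    have h₁ := evenStep_takes (k := k) (B := B) (m := m)
      (le_trans (Nat.pow_le_pow_right (by norm_num) (by omega)) hB) (by omega)
      (s := { s with input := List.replicate j (.inp (.bit true)) ++ .inp .semicolon :: l })
      ⟨hs.1, hs.2, hs.3, hs.4, hs.5, hs.6, hs.7⟩ hw
    refine (Takes.loop_cons (k := .input) hi rfl h₁ (ih (k + 1) hB hm
      { s with
        input := List.replicate j (.inp (.bit true)) ++ .inp .semicolon :: l
        words := encodeWords (evenWords (k + 1)) }
      ⟨hs.1, hs.2, hs.3, hs.4, hs.5, hs.6, hs.7⟩ rfl rfl)).congr rfl ?_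
    rw [Nat.add_one_mul j]
    omega

/-- Extending all words by a row of a generator matrix, which is on the stack `outer`. -/
def rowStep : StkProgram :=
  seq (mapWords (appendCoord (true, 1))) <| seq (move .outer .row) <|
    seq (mapWords (appendCoord (true, oddPerm))) <| seq (clear .row) replaceWords

/-- A bound for the time of `rowStep`. -/
def rowStepTime (B m : ℕ) : ℕ := 2 * (B * (9 * m + 7)) + 4 * m + 4 * (B * (m + 1)) + 8

theorem rowStep_takes {E : List (List Coord)} {p : List Coord} {B m : ℕ}
    (hE : E.length + E.length ≤ B) (hp : p.length ≤ m) (hm : ∀ w ∈ E, w.length + 1 ≤ m) {s : Store}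
    (hs : s.Idle) (hw : s.words = encodeWords E) (ho : s.outer = (p.map .elt).reverse) :
    rowStep.Takes s { s with words := encodeWords (extendWords E p), outer := [] }
      (rowStepTime B m) := by
  have hm' : ∀ w ∈ E, w.length ≤ m := fun w hw => by have := hm w hw; omega
  have h₁ := mapWords_appendCoord_takes (true, 1) (p := []) hm' hw hs.row hs.rowRest hs.value
    hs.valueRest hs.carry hs.wordsRest
  -- The row was collected on `outer` in reverse order; moving it restores the order. The pass
  -- before this one used an empty `row` and so copied the words unchanged.
  have h₂ : (move .outer .row).Takes { s with
      dest := (encodeWords (E.map fun w => mulWord [] w ++ [(true, 1)])).reverse ++ s.dest } { s with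
      dest := (encodeWords (E.map fun w => mulWord [] w ++ [(true, 1)])).reverse ++ s.dest
      row := p.map .elt
      outer := [] } (2 * m + 1) := by
    refine (Takes.move (by decide) { s with
      dest := (encodeWords (E.map fun w => mulWord [] w ++ [(true, 1)])).reverse ++ s.dest }).congr
      ?_ ?_
    · ext1 <;> first | rfl | simp [Store.get, Store.set, ho, hs.row]
    · simp only [Store.get, ho, List.length_reverse, List.length_map]
      omega
  have h₃ := mapWords_appendCoord_takes (true, oddPerm) (p := p) (s := { s with
    dest := (encodeWords (E.map fun w => mulWord [] w ++ [(true, 1)])).reverse ++ s.dest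
    row := p.map .elt
    outer := [] }) hm' hw rfl hs.rowRest hs.value hs.valueRest hs.carry hs.wordsRest
  have h₄ : (clear .row).Takes { s with
      dest := (encodeWords (E.map fun w => mulWord p w ++ [(true, oddPerm)])).reverse ++
        ((encodeWords (E.map fun w => mulWord [] w ++ [(true, 1)])).reverse ++ s.dest)
      row := p.map .elt
      outer := [] } { s with
      dest := (encodeWords (extendWords E p)).reverse
      outer := [] } (2 * m + 1) := by
    refine (Takes.clear .row { s with
      dest := (encodeWords (E.map fun w => mulWord p w ++ [(true, oddPerm)])).reverse ++
        ((encodeWords (E.map fun w => mulWord [] w ++ [(true, 1)])).reverse ++ s.dest)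
      row := p.map .elt
      outer := [] }).congr ?_ ?_
    · ext1 <;> first
        | rfl
        | simp [Store.set, hs.row, hs.dest, encodeWords, extendWords]
    · simp only [Store.get, List.length_map]
      omega
  have h₅ := replaceWords_takes (E := E) (F := extendWords E p) (B := B) (m := m) (by omega)
    (by simpa [extendWords] using hE) hm' (by
      intro w hw
      simp only [extendWords, List.mem_append, List.mem_map] at hw
      rcases hw with ⟨v, hv, rfl⟩ | ⟨v, hv, rfl⟩ <;> simpa [length_mulWord] using hm v hv)
    (s := { s with dest := (encodeWords (extendWords E p)).reverse, outer := [] }) hw rfl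
  refine (Takes.seq h₁ (Takes.seq h₂ (Takes.seq h₃ (Takes.seq h₄ h₅)))).congr ?_ ?_
  · ext1 <;> first | rfl | exact hs.dest.symm
  · have := Nat.mul_le_mul_right (9 * m + 7) (by omega : E.length ≤ B)
    unfold rowStepTime
    omega

/-! ### Reading generator matrices -/

/-- Processing one symbol of a generator matrix. -/
def readSymbol : StkSym → StkProgram
  | .inp (.bit b) => push .outer (.elt (false, if b then oddPerm else 1))
  | .inp .comma => seq (push .countD (.inp .comma)) rowStep
  | _ => skip

/-- Reading a generator matrix. -/
def readMatrix : StkProgram := loop .input neSemicolon readSymbol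

/-- A row of a generator matrix as written on the stack of inputs. -/
def encodeRow {n : ℕ} (r : Fin n → ZMod 2) : List StkSym :=
  (List.finRange n).map fun j => .inp (.bit (decide (r j = 1)))

theorem readBits_takes {n : ℕ} (r : Fin n → ZMod 2) (J : List (Fin n)) :
    ∀ (l : List StkSym) (s s' : Store) (t : ℕ),
      s.input = (J.map fun j => .inp (.bit (decide (r j = 1)))) ++ l →
      readMatrix.Takes { s with
        input := l
        outer := (J.map fun j => .elt (false, ofParity (r j))).reverse ++ s.outer } s' t →
      readMatrix.Takes s s' (2 * J.length + t) := by
  induction J with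
  | nil =>
    intro l s s' t hi h
    convert h using 1
    · ext1 <;> first | rfl | simpa using hi
    · simp
  | cons j J ih =>
    intro l s s' t hi h
    have e : (if decide (r j = 1) then oddPerm else 1) = ofParity (r j) := by
      generalize r j = c
      fin_cases c <;> rfl
    have h₁ := Takes.push .outer (.elt (false, if decide (r j = 1) then oddPerm else 1))
      (s.set .input ((J.map fun j => .inp (.bit (decide (r j = 1)))) ++ l))
    rw [e] at h₁
    refine (Takes.loop_cons (k := .input) (f := readSymbol) hi rfl (by
      change (push .outer (.elt (false, if decide (r j = 1) then oddPerm else 1))).Takes _ _ _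
      rw [e]
      exact h₁) (ih l _ s' t rfl ?_)).mono
        (by simp only [List.length_cons]; omega)
    convert h using 1
    ext1 <;> first | rfl | simp [Store.get, Store.set]

/-- Here `R` has been read and `R'` is still to come. Each row doubles the list of words and leaves
a mark on `countD`, from which the dimensions are compared later. -/
theorem readMatrix_takes {n B m : ℕ} (l : List StkSym) (R' : List (Fin n → ZMod 2)) :
    ∀ (R : List (Fin n → ZMod 2)), 60 ^ n * 2 ^ (R.length + R'.length) ≤ B →
    n + (R.length + R'.length) ≤ m → ∀ (s : Store), s.Idle → s.outer = [] →
    s.words = encodeWords (codeWords R) →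
    s.input = (R'.flatMap fun r => encodeRow r ++ [.inp .comma]) ++ .inp .semicolon :: l →
    readMatrix.Takes s { s with
      input := l
      words := encodeWords (codeWords (R ++ R'))
      countD := List.replicate R'.length (.inp .comma) ++ s.countD }
      (R'.length * (2 * n + 2 + rowStepTime B m) + 1) := by
  induction R' with
  | nil =>
    intro R _ _ s _ _ hw hi
    refine (Takes.loop_exit (k := .input) hi rfl).congr ?_ (by simp)
    ext1 <;> first | rfl | simp [Store.set, hw]
  | cons r R' ih =>
    intro R hB hm s hs ho hw hi
    have e : R.length + (r :: R').length = (R ++ [r]).length + R'.length := by simp; omega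
    rw [e] at hB hm
    have hl : (rowWord r).length = n := by simp [rowWord]
    have h₁ := rowStep_takes (E := codeWords R) (p := rowWord r) (B := B) (m := m) (by
        rw [length_codeWords, ← mul_two, mul_assoc, ← pow_succ]
        refine le_trans (Nat.mul_le_mul_left _ (Nat.pow_le_pow_right (by norm_num) ?_)) hB
        simp) (by rw [hl]; omega) (by
        intro w hw
        rw [length_of_mem_codeWords hw]
        simp only [List.length_append, List.length_singleton] at hm
        omega) (s := { s with
          input := (R'.flatMap fun r => encodeRow r ++ [.inp .comma]) ++ .inp .semicolon :: l
          outer := ((rowWord r).map .elt).reverse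
          countD := .inp .comma :: s.countD }) ⟨hs.1, hs.2, hs.3, hs.4, hs.5, hs.6, hs.7⟩ hw rfl
    have h₂ := ih (R ++ [r]) hB hm { s with
      input := (R'.flatMap fun r => encodeRow r ++ [.inp .comma]) ++ .inp .semicolon :: l
      words := encodeWords (codeWords (R ++ [r]))
      outer := []
      countD := .inp .comma :: s.countD } ⟨hs.1, hs.2, hs.3, hs.4, hs.5, hs.6, hs.7⟩ rfl rfl rfl
    rw [← codeWords_append] at h₁
    have h₃ := readBits_takes r (List.finRange n) (.inp .comma ::
      ((R'.flatMap fun r => encodeRow r ++ [.inp .comma]) ++ .inp .semicolon :: l)) s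
      _ _ (by simp [hi, encodeRow]) (Takes.loop_cons (k := .input) (f := readSymbol) rfl rfl
        (Takes.seq (Takes.push _ _ _) (by
          convert h₁ using 1
          ext1 <;> first
            | rfl
            | simp [Store.get, Store.set, ho, rowWord, List.ofFn_eq_map])) h₂)
    refine h₃.congr ?_ ?_
    · ext1 <;> first | rfl | exact ho.symm | simp [List.replicate_succ']
    · rw [List.length_cons, Nat.add_one_mul R'.length, List.length_finRange]
      omega

/-! ### Writing multiplication tables -/

/-- Processing one symbol of the list of words on `outer`: at the end of a word, the corresponding
row of the multiplication table is written. -/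
noncomputable def tableSymbol : StkSym → StkProgram
  | .elt a => push .rowRest (.elt a)
  | .inp _ => seq (move .rowRest .row) <| seq (mapWords writeLabel) <|
      seq (push .out (.inp .semicolon)) (clear .row)
  | .carry _ => skip

/-- Writing the multiplication table. -/
noncomputable def writeTable : StkProgram :=
  seq (copy .words .outer .wordsRest) (loop .outer (fun _ => true) tableSymbol)

/-- A bound for the time to write a row of the multiplication table. -/
def tableRowTime (B m : ℕ) : ℕ :=
  B * (9 * m + (m * (36 * m + 35) + 12 * m + 3) + 5) + 2

/-- A bound for the time of `writeTable`. -/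
def tableTime (B m : ℕ) : ℕ := 5 * (B * (m + 1)) + 2 + (B * (6 * m + tableRowTime B m + 4) + 1)

theorem tableSymbols_takes (w : List Coord) : ∀ (l : List StkSym) (s s' : Store) (t : ℕ),
    s.outer = w.map .elt ++ l →
    (loop .outer (fun _ => true) tableSymbol).Takes { s with
        outer := l
        rowRest := (w.map .elt).reverse ++ s.rowRest } s' t →
      (loop .outer (fun _ => true) tableSymbol).Takes s s' (2 * w.length + t) := by
  induction w with
  | nil =>
    intro l s s' t ho h
    convert h using 1
    · ext1 <;> first | rfl | simpa using ho
    · simp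
  | cons a w ih =>
    intro l s s' t ho h
    refine (Takes.loop_cons (k := .outer) (f := tableSymbol) ho rfl (Takes.push .rowRest (.elt a) _)
      (ih l _ s' t rfl ?_)).mono (by simp only [List.length_cons]; omega)
    convert h using 1
    ext1 <;> first | rfl | simp [Store.get, Store.set]

/-- `F` consists of the left factors whose rows are not yet written, while the right factors always
run through all of `E`; this is why the list is first copied to `outer`. -/
theorem tableLoop_takes {E : List (List Coord)} {B m : ℕ} (hE : E.length ≤ B)
    (hm : ∀ w ∈ E, w.length ≤ m) (F : List (List Coord)) :
    ∀ (_ : ∀ w ∈ F, w.length ≤ m) (s : Store), s.Idle → s.words = encodeWords E →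
      s.outer = encodeWords F →
      (loop .outer (fun _ => true) tableSymbol).Takes s { s with
        outer := []
        out := ((F.flatMap fun g =>
          (E.flatMap fun h => encodeNat (wordLabel (mulWord g h)) ++ [InputSymbol.comma]) ++
            [InputSymbol.semicolon]).map StkSym.inp).reverse ++ s.out }
        (F.length * (6 * m + tableRowTime B m + 4) + 1) := by
  induction F with
  | nil =>
    intro _ s _ _ ho
    refine (Takes.loop_nil (k := .outer) ho).congr ?_ (by simp)
    ext1 <;> first | rfl | exact ho
  | cons w F ih =>
    intro hF s hs hw ho
    have hwm := hF w (by simp)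
    have h₁ : (move .rowRest .row).Takes { s with
        outer := encodeWords F
        rowRest := (w.map .elt).reverse ++ s.rowRest } { s with
        outer := encodeWords F
        row := w.map .elt } (2 * m + 1) := by
      refine (Takes.move (by decide) _).congr ?_ ?_
      · ext1 <;> first | rfl | simp [Store.get, Store.set, hs.row, hs.rowRest]
      · simp only [Store.get, hs.rowRest, List.append_nil, List.length_reverse, List.length_map]
        omega
    have h₂ := mapWords_writeLabel_takes (p := w) hm (s := { s with
        outer := encodeWords F
        row := w.map .elt }) hw rfl hs.rowRest hs.value hs.valueRest hs.carry hs.wordsRest hs.dest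
    have h₃ := Takes.push .out (.inp .semicolon) { s with
      outer := encodeWords F
      row := w.map .elt
      out := ((E.flatMap fun h => encodeNat (wordLabel (mulWord w h)) ++ [InputSymbol.comma]).map
        StkSym.inp).reverse ++ s.out }
    have h₄ : (clear .row).Takes { s with
        outer := encodeWords F
        row := w.map .elt
        out := .inp .semicolon :: (((E.flatMap fun h => encodeNat (wordLabel (mulWord w h)) ++
          [InputSymbol.comma]).map StkSym.inp).reverse ++ s.out) } { s with
        outer := encodeWords F
        out := .inp .semicolon :: (((E.flatMap fun h => encodeNat (wordLabel (mulWord w h)) ++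
          [InputSymbol.comma]).map StkSym.inp).reverse ++ s.out) } (2 * m + 1) := by
      refine (Takes.clear _ _).congr ?_ ?_
      · ext1 <;> first | rfl | simp [Store.set, hs.row]
      · simp only [Store.get, List.length_map]
        omega
    have h₅ := ih (fun v hv => hF v (by simp [hv])) { s with
        outer := encodeWords F
        out := .inp .semicolon :: (((E.flatMap fun h => encodeNat (wordLabel (mulWord w h)) ++
          [InputSymbol.comma]).map StkSym.inp).reverse ++ s.out) }
      ⟨hs.1, hs.2, hs.3, hs.4, hs.5, hs.6, hs.7⟩ hw rfl
    refine (tableSymbols_takes w (.inp .comma :: encodeWords F) s _ _ (by simp [ho, encodeWords])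
      (Takes.loop_cons (k := .outer) (f := tableSymbol) rfl rfl
        (Takes.seq h₁ (Takes.seq h₂ (Takes.seq h₃ h₄))) h₅)).congr ?_ ?_
    · ext1 <;> first | rfl | simp
    · have := Nat.mul_le_mul_right (9 * m + (m * (36 * m + 35) + 12 * m + 3) + 5) hE
      rw [List.length_cons, Nat.add_one_mul F.length]
      unfold tableRowTime
      omega

theorem writeTable_takes {E : List (List Coord)} {B m : ℕ} (hE : E.length ≤ B)
    (hm : ∀ w ∈ E, w.length ≤ m) {s : Store} (hs : s.Idle) (ho : s.outer = [])
    (hw : s.words = encodeWords E) : writeTable.Takes s { s with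
      out := ((wordTable E).map StkSym.inp).reverse ++ s.out } (tableTime B m) := by
  have h₁ := Takes.copy (k := .words) (j := .outer) (i := .wordsRest) (by decide) (by decide)
    (by decide) s hs.wordsRest
  have h₂ := tableLoop_takes hE hm E hm { s with outer := encodeWords E }
    ⟨hs.1, hs.2, hs.3, hs.4, hs.5, hs.6, hs.7⟩ hw rfl
  refine (Takes.seq h₁ (by
    convert h₂ using 1
    ext1 <;> first | rfl | simp [Store.get, Store.set, hw, ho])).congr ?_ ?_
  · ext1 <;> first | rfl | exact ho.symm
  · have h₃ := (length_encodeWords_le hm).trans (Nat.mul_le_mul_right (m + 1) hE)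
    have h₄ := Nat.mul_le_mul_right (6 * m + tableRowTime B m + 4) hE
    simp only [Store.get, hw]
    unfold tableTime
    omega

/-! ### Comparing dimensions and assembling the reduction -/

/-- If the stacks `countC` and `countD` have different sizes, the stack `out` is emptied. -/
def compareCounts : StkProgram :=
  seq (loop .countC (fun _ => true) fun _ => branch .countD fun
      | some _ => skip
      | none => push .carry (.inp .comma)) <|
    seq (move .countD .carry) <| branch .carry fun
      | some _ => seq (clear .carry) (clear .out)
      | none => skip

/-- With truncated subtraction, the surplus of `countD` stays there and that of `countC` is recorded
on `carry`; the counts agree exactly if both surpluses are empty. -/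
theorem compareLoop_takes (a : ℕ) : ∀ (b : ℕ) (s : Store),
    s.countC = List.replicate a (.inp .comma) → s.countD = List.replicate b (.inp .comma) →
    (loop .countC (fun _ => true) fun _ => branch .countD fun
      | some _ => skip
      | none => push .carry (.inp .comma) : StkProgram).Takes s { s with
        countC := []
        countD := List.replicate (b - a) (.inp .comma)
        carry := List.replicate (a - b) (.inp .comma) ++ s.carry } (3 * a + 1) := by
  induction a with
  | zero =>
    intro b s hC hD
    refine (Takes.loop_nil (k := .countC) hC).congr ?_ (by simp)
    ext1 <;> first | rfl | simp [hC, hD]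
  | succ a ih =>
    intro b s hC hD
    cases b with
    | zero =>
      refine (Takes.loop_cons (k := .countC) hC rfl
        (Takes.branch_nil (k := .countD)
          (s := s.set .countC (List.replicate a (.inp .comma))) hD (Takes.push _ _ _)) (ih 0 { s with
          countC := List.replicate a (.inp .comma)
          carry := .inp .comma :: s.carry } rfl hD)).congr (t := (1 + 1) + (3 * a + 1) + 1) ?_ (by omega)
      ext1 <;> first | rfl | simp [List.replicate_succ']
    | succ b =>
      refine (Takes.loop_cons (k := .countC) hC rfl
        (Takes.branch_cons (k := .countD)
          (s := s.set .countC (List.replicate a (.inp .comma))) hD (Takes.skip _)) (ih b { s with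
          countC := List.replicate a (.inp .comma)
          countD := List.replicate b (.inp .comma) } rfl rfl)).congr (t := (1 + 1) + (3 * a + 1) + 1) ?_ (by omega)
      ext1 <;> first | rfl | simp

theorem compareCounts_takes {a b : ℕ} {s : Store} (hC : s.countC = List.replicate a (.inp .comma))
    (hD : s.countD = List.replicate b (.inp .comma)) (hc : s.carry = []) :
    compareCounts.Takes s { s with
      countC := []
      countD := []
      out := if a = b then s.out else [] } (5 * a + 4 * b + 2 * s.out.length + 6) := by
  have h₁ := compareLoop_takes a b s hC hD
  have h₂ : (move .countD .carry).Takes { s with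
      countC := []
      countD := List.replicate (b - a) (.inp .comma)
      carry := List.replicate (a - b) (.inp .comma) ++ s.carry } { s with
      countC := []
      countD := []
      carry := List.replicate (b - a + (a - b)) (.inp .comma) } (2 * b + 1) := by
    refine (Takes.move (by decide) _).congr ?_ ?_
    · ext1 <;> first | rfl | simp [Store.get, Store.set, hc]
    · simp only [Store.get, List.length_replicate]
      omega
  refine (Takes.seq h₁ (Takes.seq h₂ (u := 2 * a + 2 * b + 2 * s.out.length + 4)
    ?_)).mono (by omega)
  by_cases h : a = b
  · subst h
    refine (Takes.branch_nil (k := .carry) (by simp [Store.get]) (Takes.skip _)).congr ?_ (by omega)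
    ext1 <;> first | rfl | simp [hc]
  · obtain ⟨j, hj⟩ : ∃ j, b - a + (a - b) = j + 1 := ⟨b - a + (a - b) - 1, by omega⟩
    refine (Takes.branch_cons (k := .carry) (by rw [hj]; rfl)
      (Takes.seq (Takes.clear _ _) (Takes.clear _ _))).congr ?_ ?_
    · ext1 <;> first | rfl | simp [Store.set, hc, h]
    · simp only [Store.get, Store.set, List.length_replicate]
      omega

/-- Reading a generator matrix and writing a multiplication table of the group of its code. -/
noncomputable def processMatrix : StkProgram := seq readMatrix writeTable

/-- Writing the multiplication tables for two codes given by generator matrices. -/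
noncomputable def writeTables : StkProgram :=
  seq (copy .words .saved .wordsRest) <| seq processMatrix <| seq (push .out (.inp .semicolon)) <|
    seq (move .countD .countC) <| seq (clear .words) <| seq (copy .saved .words .wordsRest) <|
    seq (clear .saved) <| seq processMatrix (clear .words)

/-- The reduction of equivalence of codes to isomorphism of groups; it has no output if the codes
have different dimensions. -/
noncomputable def reduction : StkProgram :=
  seq (move .dest .input) <| seq (push .words (.inp .comma)) <|
    seq (loop .input neSemicolon fun _ => evenStep) <| seq writeTables compareCounts

/-- A generator matrix, given by its rows, as written on the stack of inputs. -/
def encodeRows {n : ℕ} (R : List (Fin n → ZMod 2)) (l : List StkSym) : List StkSym :=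
  (R.flatMap fun r => encodeRow r ++ [.inp .comma]) ++ .inp .semicolon :: l

/-- A bound for the time of `processMatrix`. -/
def processTime (n B m : ℕ) : ℕ := m * (2 * n + 2 + rowStepTime B m) + 1 + tableTime B m

theorem processMatrix_takes {n B m : ℕ} {R : List (Fin n → ZMod 2)} {l : List StkSym}
    (hB : 60 ^ n * 2 ^ R.length ≤ B) (hm : n + R.length ≤ m) {s : Store} (hs : s.Idle)
    (ho : s.outer = []) (hw : s.words = encodeWords (evenWords n)) (hi : s.input = encodeRows R l) :
    processMatrix.Takes s { s with
      input := l
      words := encodeWords (codeWords R)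
      countD := List.replicate R.length (.inp .comma) ++ s.countD
      out := ((wordTable (codeWords R)).map StkSym.inp).reverse ++ s.out } (processTime n B m) := by
  have h₁ := readMatrix_takes (B := B) (m := m) l R [] (by simpa using hB) (by simpa using hm) s hs
    ho (by simp [hw, codeWords]) hi
  have h₂ := writeTable_takes (E := codeWords R) (B := B) (m := m) (by rwa [length_codeWords])
    (fun w hw => by rwa [length_of_mem_codeWords hw]) (s := { s with
      input := l
      words := encodeWords (codeWords R)
      countD := List.replicate R.length (.inp .comma) ++ s.countD })
    ⟨hs.1, hs.2, hs.3, hs.4, hs.5, hs.6, hs.7⟩ ho rfl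
  refine (Takes.seq h₁ h₂).mono ?_
  have := Nat.mul_le_mul_right (2 * n + 2 + rowStepTime B m) (by omega : R.length ≤ m)
  unfold processTime
  omega

/-- The output of the reduction if the codes have the same dimension. -/
noncomputable def codeTables {n : ℕ} (R R' : List (Fin n → ZMod 2)) : List InputSymbol :=
  wordTable (codeWords R) ++ [.semicolon] ++ wordTable (codeWords R')

/-- A bound for the time of `writeTables`. -/
def writeTablesTime (n B m : ℕ) : ℕ :=
  2 * processTime n B m + 16 * (B * (m + 1)) + 2 * m + 9

/-- Both codes start from the same list of even words, which is saved while the first table is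
written. Moving the first row count to `countC` frees `countD` for the second matrix. -/
theorem writeTables_takes {n B m : ℕ} {R R' : List (Fin n → ZMod 2)}
    (hB : 60 ^ n * 2 ^ R.length ≤ B) (hB' : 60 ^ n * 2 ^ R'.length ≤ B) (hm : n + R.length ≤ m)
    (hm' : n + R'.length ≤ m) :
    writeTables.Takes
      { input := encodeRows R (encodeRows R' []), words := encodeWords (evenWords n) }
      { countC := List.replicate R.length (.inp .comma)
        countD := List.replicate R'.length (.inp .comma)
        out := ((codeTables R R').map StkSym.inp).reverse } (writeTablesTime n B m) := by
  have hl : ∀ Q : List (Fin n → ZMod 2), 60 ^ n * 2 ^ Q.length ≤ B → n + Q.length ≤ m →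
      (encodeWords (codeWords Q)).length ≤ B * (m + 1) := fun Q hQ hQm =>
    (length_encodeWords_le fun w hw => by rwa [length_of_mem_codeWords hw]).trans
      (Nat.mul_le_mul_right _ (by rwa [length_codeWords]))
  -- The even words are the words of the zero code, given by no rows.
  have hl₀ : (encodeWords (evenWords n)).length ≤ B * (m + 1) := by
    have := hl ([] : List (Fin n → ZMod 2))
      (le_trans (Nat.mul_le_mul_left _ (Nat.pow_le_pow_right (by norm_num) (Nat.zero_le _))) hB)
      (by simp only [List.length_nil]; omega)
    simpa [codeWords] using this
  have h₁ := Takes.copy (k := .words) (j := .saved) (i := .wordsRest) (by decide) (by decide)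
    (by decide) { input := encodeRows R (encodeRows R' []), words := encodeWords (evenWords n) } rfl
  have h₂ := processMatrix_takes hB hm (s := {
    input := encodeRows R (encodeRows R' [])
    words := encodeWords (evenWords n)
    saved := encodeWords (evenWords n) }) (l := encodeRows R' []) ⟨rfl, rfl, rfl, rfl, rfl, rfl, rfl⟩
    rfl rfl rfl
  have h₃ := Takes.push .out (.inp .semicolon) {
    input := encodeRows R' []
    words := encodeWords (codeWords R)
    saved := encodeWords (evenWords n)
    countD := List.replicate R.length (.inp .comma)
    out := ((wordTable (codeWords R)).map StkSym.inp).reverse }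
  have h₄ := Takes.move (k := .countD) (j := .countC) (by decide) {
    input := encodeRows R' []
    words := encodeWords (codeWords R)
    saved := encodeWords (evenWords n)
    countD := List.replicate R.length (.inp .comma)
    out := .inp .semicolon :: ((wordTable (codeWords R)).map StkSym.inp).reverse }
  have h₅ := Takes.clear .words {
    input := encodeRows R' []
    words := encodeWords (codeWords R)
    saved := encodeWords (evenWords n)
    countC := List.replicate R.length (.inp .comma)
    out := .inp .semicolon :: ((wordTable (codeWords R)).map StkSym.inp).reverse }
  have h₆ := Takes.copy (k := .saved) (j := .words) (i := .wordsRest) (by decide) (by decide)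
    (by decide) {
    input := encodeRows R' []
    saved := encodeWords (evenWords n)
    countC := List.replicate R.length (.inp .comma)
    out := .inp .semicolon :: ((wordTable (codeWords R)).map StkSym.inp).reverse } rfl
  have h₇ := Takes.clear .saved {
    input := encodeRows R' []
    words := encodeWords (evenWords n)
    saved := encodeWords (evenWords n)
    countC := List.replicate R.length (.inp .comma)
    out := .inp .semicolon :: ((wordTable (codeWords R)).map StkSym.inp).reverse }
  have h₈ := processMatrix_takes hB' hm' (s := {
    input := encodeRows R' []
    words := encodeWords (evenWords n)
    countC := List.replicate R.length (.inp .comma)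
    out := .inp .semicolon :: ((wordTable (codeWords R)).map StkSym.inp).reverse }) (l := [])
    ⟨rfl, rfl, rfl, rfl, rfl, rfl, rfl⟩ rfl rfl rfl
  have h₉ := Takes.clear .words {
    words := encodeWords (codeWords R')
    countC := List.replicate R.length (.inp .comma)
    countD := List.replicate R'.length (.inp .comma)
    out := ((codeTables R R').map StkSym.inp).reverse }
  have e₁ := h₁.congr (s'' := {
    input := encodeRows R (encodeRows R' [])
    words := encodeWords (evenWords n)
    saved := encodeWords (evenWords n) })
    (by ext1 <;> first | rfl | simp [Store.get, Store.set]) le_rfl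
  have e₂ := h₂.congr (s'' := {
    input := encodeRows R' []
    words := encodeWords (codeWords R)
    saved := encodeWords (evenWords n)
    countD := List.replicate R.length (.inp .comma)
    out := ((wordTable (codeWords R)).map StkSym.inp).reverse })
    (by ext1 <;> first | rfl | simp) le_rfl
  have e₄ := h₄.congr (s'' := {
    input := encodeRows R' []
    words := encodeWords (codeWords R)
    saved := encodeWords (evenWords n)
    countC := List.replicate R.length (.inp .comma)
    out := .inp .semicolon :: ((wordTable (codeWords R)).map StkSym.inp).reverse })
    (by ext1 <;> first | rfl | simp [Store.get, Store.set]) le_rfl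
  have e₆ := h₆.congr (s'' := {
    input := encodeRows R' []
    words := encodeWords (evenWords n)
    saved := encodeWords (evenWords n)
    countC := List.replicate R.length (.inp .comma)
    out := .inp .semicolon :: ((wordTable (codeWords R)).map StkSym.inp).reverse })
    (by ext1 <;> first | rfl | simp [Store.get, Store.set]) le_rfl
  have e₈ := h₈.congr (s'' := {
    words := encodeWords (codeWords R')
    countC := List.replicate R.length (.inp .comma)
    countD := List.replicate R'.length (.inp .comma)
    out := ((codeTables R R').map StkSym.inp).reverse })
    (by ext1 <;> first | rfl | simp [codeTables]) le_rfl
  refine (Takes.seq e₁ <| Takes.seq e₂ <| Takes.seq h₃ <| Takes.seq e₄ <| Takes.seq h₅ <|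
    Takes.seq e₆ <| Takes.seq h₇ <| Takes.seq e₈ h₉).congr rfl ?_
  have l₁ := hl R hB hm
  have l₂ := hl R' hB' hm'
  simp only [Store.get, List.length_replicate]
  unfold writeTablesTime
  omega

theorem map_inp_encodeMatrix {d n : ℕ} (A : Matrix (Fin d) (Fin n) (ZMod 2)) (l : List StkSym) :
    (encodeMatrix A).map StkSym.inp ++ l = encodeRows (List.ofFn A.row) l := by
  rw [encodeRows, List.ofFn_eq_map, List.flatMap_map]
  simp [encodeMatrix, encodeRow, List.map_flatMap, Function.comp_def, Matrix.row]
  rfl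

theorem CodePair.map_inp_encode (x : CodePair) : x.encode.map StkSym.inp =
    List.replicate x.n (.inp (.bit true)) ++
      .inp .semicolon :: encodeRows (List.ofFn x.genC.row) (encodeRows (List.ofFn x.genD.row) []) := by
  rw [← map_inp_encodeMatrix, ← map_inp_encodeMatrix]
  simp [CodePair.encode]

theorem length_encodeMatrix {d n : ℕ} (A : Matrix (Fin d) (Fin n) (ZMod 2)) :
    (encodeMatrix A).length = d * (n + 1) + 1 := by
  simp [encodeMatrix, List.length_flatMap]

theorem CodePair.length_encode (x : CodePair) :
    x.encode.length = x.n + x.dimC * (x.n + 1) + x.dimD * (x.n + 1) + 3 := by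
  simp [CodePair.encode, length_encodeMatrix]
  ring

/-- A bound for the time until the multiplication tables are written. -/
def tablesTime (n L B m : ℕ) : ℕ :=
  2 * L + 3 + m * (evenStepTime B m + 1) + writeTablesTime n B m

/-- A bound for the time of the reduction. -/
def reductionTime (n L B m : ℕ) : ℕ := 3 * tablesTime n L B m + 9 * m + 6

theorem reduction_takes {n B m : ℕ} {R R' : List (Fin n → ZMod 2)}
    (hB : 60 ^ n * 2 ^ R.length ≤ B) (hB' : 60 ^ n * 2 ^ R'.length ≤ B) (hm : n + R.length ≤ m)
    (hm' : n + R'.length ≤ m) {l : List StkSym} (hl : l = List.replicate n (.inp (.bit true)) ++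
      .inp .semicolon :: encodeRows R (encodeRows R' [])) :
    reduction.Takes { dest := l.reverse }
      { out := if R.length = R'.length then ((codeTables R R').map StkSym.inp).reverse else [] }
      (reductionTime n l.length B m) := by
  have hB₀ : 60 ^ (0 + n) ≤ B := by
    rw [zero_add]
    exact le_trans (Nat.le_mul_of_pos_right _ (by positivity)) hB
  have h₁ : (move .dest .input).Takes { dest := l.reverse } { input := l } (2 * l.length + 1) := by
    refine (Takes.move (by decide) _).congr ?_ ?_
    · ext1 <;> first | rfl | simp [Store.get, Store.set]
    · simp [Store.get]
  have h₂ := Takes.push .words (.inp .comma) { input := l }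
  -- The single comma just pushed encodes the list containing only the empty word, which is
  -- `evenWords 0`.
  have h₃ := evenSteps_takes (B := B) (m := m) (encodeRows R (encodeRows R' [])) n 0 hB₀ (by omega)
    { input := l, words := encodeWords (evenWords 0) } ⟨rfl, rfl, rfl, rfl, rfl, rfl, rfl⟩ rfl hl
  rw [zero_add] at h₃
  have h₄ := writeTables_takes hB hB' hm hm'
  have h₅ := compareCounts_takes (s := {
    countC := List.replicate R.length (.inp .comma)
    countD := List.replicate R'.length (.inp .comma)
    out := ((codeTables R R').map StkSym.inp).reverse }) rfl rfl rfl
  have hn := Nat.mul_le_mul_right (evenStepTime B m + 1) (by omega : n ≤ m)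
  have h₆ := (Takes.seq h₁ (Takes.seq h₂ (Takes.seq h₃ h₄))).mono
    (u := tablesTime n l.length B m) (by unfold tablesTime; omega)
  -- The output is no longer than the time spent writing it, and clearing it costs two steps per
  -- symbol; hence the factor 3 in `reductionTime`.
  have h₇ := Runs.length_le h₆ .out
  refine (Takes.seq h₁ (Takes.seq h₂ (Takes.seq h₃ (Takes.seq h₄ h₅)))).mono ?_
  simp only [Store.get, List.length_nil, zero_add] at h₇
  unfold reductionTime
  unfold tablesTime at h₇ ⊢
  simp only
  omega

/-! ### Estimates for the running time of the reduction -/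

theorem evenStepTime_le {B m : ℕ} (hB : 1 ≤ B) : evenStepTime B m ≤ 700 * (B * (m + 1)) := by
  unfold evenStepTime
  nlinarith

theorem rowStepTime_le {B m : ℕ} (hB : 1 ≤ B) : rowStepTime B m ≤ 40 * (B * (m + 1)) := by
  unfold rowStepTime
  nlinarith

theorem tableRowTime_le {B m : ℕ} (hB : 1 ≤ B) :
    tableRowTime B m ≤ 50 * (B * (m + 1) ^ 2) := by
  unfold tableRowTime
  nlinarith [Nat.zero_le (B * m), Nat.zero_le (B * m ^ 2)]

/-- The dominant cost of the reduction: at most $B^2$ products, each needing $O(m^2)$ steps because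
Horner's rule handles numbers of $O(m)$ bits for each of at most $m$ coordinates. -/
theorem tableTime_le {B m : ℕ} (hB : 1 ≤ B) : tableTime B m ≤ 70 * (B ^ 2 * (m + 1) ^ 2) := by
  have h₁ := Nat.mul_le_mul_left B (tableRowTime_le (m := m) hB)
  have h₂ : B * (m + 1) ^ 2 ≤ B ^ 2 * (m + 1) ^ 2 :=
    Nat.mul_le_mul_right _ (Nat.le_self_pow (by norm_num) B)
  unfold tableTime
  nlinarith [Nat.zero_le (B * m), Nat.zero_le (B * m ^ 2)]

theorem reductionTime_le {n L B m : ℕ} (hB : 1 ≤ B) (hn : n ≤ m) (hL : L ≤ 3 * (m + 1) ^ 2) :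
    reductionTime n L B m ≤ 10000 * (B ^ 2 * (m + 1) ^ 2) := by
  have h₁ := Nat.mul_le_mul_left m (evenStepTime_le (m := m) hB)
  have h₂ := Nat.mul_le_mul_left m (rowStepTime_le (m := m) hB)
  have h₃ := tableTime_le (m := m) hB
  have h₄ : B * (m + 1) ^ 2 ≤ B ^ 2 * (m + 1) ^ 2 :=
    Nat.mul_le_mul_right _ (Nat.le_self_pow (by norm_num) B)
  have h₅ : 1 * (m + 1) ^ 2 ≤ B * (m + 1) ^ 2 := Nat.mul_le_mul_right _ hB
  have h₆ : m * n ≤ m * m := Nat.mul_le_mul_left m hn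
  unfold reductionTime tablesTime writeTablesTime processTime
  nlinarith [Nat.zero_le (B * m), Nat.zero_le (B * m ^ 2)]

/-! ### Bounds for times -/

/-- The comma after each entry already gives $N^2$ symbols. -/
theorem length_encodeTable_ge {N : ℕ} (T : Matrix (Fin N) (Fin N) (Fin N)) :
    N ^ 2 ≤ (encodeTable T).length := by
  have h : ∀ i, N ≤ (((List.finRange N).flatMap fun j => encodeNat (T i j) ++
      [InputSymbol.comma]) ++ [InputSymbol.semicolon]).length := fun i => by
    simp only [List.length_append, List.length_flatMap, List.length_singleton]
    refine le_trans ?_ (Nat.le_add_right _ _)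
    simp
  rw [encodeTable, List.length_flatMap, sq]
  simpa using List.sum_le_sum (l := List.finRange N) (f := fun _ => N) fun i _ => h i

/-- An instance of the isomorphism problem that consists of two copies of the group of a code. -/
theorem exists_pair {d d' n : ℕ} {A : Matrix (Fin d) (Fin n) (ZMod 2)}
    {B : Matrix (Fin d') (Fin n) (ZMod 2)} {C D : BinaryCode n} (hA : IsGeneratorMatrix A C)
    (hB : IsGeneratorMatrix B D) (h : d = d') : ∃ x : FittingFreePair,
      x.order = 60 ^ n * 2 ^ d ∧ (x.Isomorphic ↔ LinearCodeEquivalent C D) ∧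
        x.encode = codeTables (List.ofFn A.row) (List.ofFn B.row) := by
  subst h
  obtain ⟨labelG, hG⟩ := exists_label hA
  obtain ⟨labelH, hH⟩ := exists_label hB
  refine ⟨⟨60 ^ n * 2 ^ d, codeGroup C, codeGroup D, labelG, labelH, codeGroup.fittingFree C,
    codeGroup.fittingFree D⟩, rfl, (linearCodeEquivalent_iff hA).symm, ?_⟩
  rw [FittingFreePair.encode, hG, hH, codeTables]

/-- The zero code has the group $A_5^n$; two copies of it form a yes-instance of order exactly
$60^n$, at which the lower bound for $t$ is obtained. -/
theorem isGeneratorMatrix_bot {n : ℕ} (A : Matrix (Fin 0) (Fin n) (ZMod 2)) :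
    IsGeneratorMatrix A (⊥ : BinaryCode n) :=
  ⟨linearIndependent_empty_type, by simp [Set.range_eq_empty]⟩

theorem LinearCodeEquivalent.refl {d n : ℕ} {A : Matrix (Fin d) (Fin n) (ZMod 2)}
    {C : BinaryCode n} (hA : IsGeneratorMatrix A C) : LinearCodeEquivalent C C :=
  (linearCodeEquivalent_iff hA).2 ⟨MulEquiv.refl _⟩

/-- As a machine has to read its input, the time for isomorphism testing is at least quadratic in
the orders of Fitting-free groups. -/
theorem sq_le_of_decides {M : Turing.TM2ComputableAux InputSymbol Bool} {c : ℕ} {t : ℕ → ℕ}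
    (hM : ∀ (x : FittingFreePair) (answer : Bool), (answer = true ↔ x.Isomorphic) →
      Nonempty (Turing.TM2OutputsInTime M.tm (x.encode.map M.inputAlphabet.symm)
        (some ([answer].map M.outputAlphabet.symm)) (c * t x.order))) :
    ∃ b, ∀ n, (60 ^ n) ^ 2 ≤ b * t (60 ^ n) := by
  obtain ⟨b, hb⟩ := Turing.exists_length_le_mul M.tm
  refine ⟨b * c, fun n => ?_⟩
  have h := isGeneratorMatrix_bot (n := n) (Matrix.of Fin.elim0)
  obtain ⟨x, hx, hiso, -⟩ := exists_pair h h rfl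
  have h₁ := hb _ _ _ (hM x true (by simpa using hiso.2 (.refl h)))
  rw [List.length_map, hx, pow_zero, mul_one] at h₁
  have h₂ : (60 ^ n) ^ 2 ≤ (encodeTable (cayleyTable x.labelG)).length := by
    refine le_trans (le_of_eq ?_) (length_encodeTable_ge _)
    rw [hx, pow_zero, mul_one]
  have h₃ : (encodeTable (cayleyTable x.labelG)).length + 1 ≤ x.encode.length := by
    simp only [FittingFreePair.encode, List.length_append, List.length_singleton]
    omega
  rw [mul_assoc]
  omega

/-- Induction in steps of three, where the exponent grows by four and
$60^4=12960000\le13824000=240^3$. -/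
theorem pow_div_le (n : ℕ) : 60 ^ (4 * n / 3) ≤ 240 ^ n := by
  induction n using Nat.strongRec with
  | _ n ih =>
    match n, ih with
    | 0, _ => norm_num
    | 1, _ => norm_num
    | 2, _ => norm_num
    | n + 3, ih =>
      have := ih n (by omega)
      rw [show 4 * (n + 3) / 3 = 4 * n / 3 + 4 by omega, pow_add, pow_add]
      exact Nat.mul_le_mul this (by norm_num)

/-- Again in steps of three: $60^4=7.5\cdot120^3$ leaves room for the growth of $2n+1$. The constant
400 is attained at $n=2$, where the quotient is $2^4\cdot5^2$. -/
theorem sq_mul_pow_le (n : ℕ) :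
    (120 ^ n) ^ 2 * (2 * n + 1) ^ 2 ≤ 400 * (60 ^ (4 * n / 3)) ^ 2 := by
  induction n using Nat.strongRec with
  | _ n ih =>
    match n, ih with
    | 0, _ => norm_num
    | 1, _ => norm_num
    | 2, _ => norm_num
    | n + 3, ih =>
      have h := ih n (by omega)
      -- The factor 15 comes from $60\cdot120^2\cdot15=60^4$; the 2 is split off from
      -- $120^3=2\cdot60\cdot120^2$.
      have h' : (2 * (2 * (n + 3) + 1)) ^ 2 ≤ (15 * (2 * n + 1)) ^ 2 :=
        Nat.pow_le_pow_left (by omega) 2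
      rw [show 4 * (n + 3) / 3 = 4 * n / 3 + 4 by omega]
      calc (120 ^ (n + 3)) ^ 2 * (2 * (n + 3) + 1) ^ 2
          = (60 * 120 ^ 2 * 120 ^ n) ^ 2 * (2 * (2 * (n + 3) + 1)) ^ 2 := by ring
        _ ≤ (60 * 120 ^ 2 * 120 ^ n) ^ 2 * (15 * (2 * n + 1)) ^ 2 := Nat.mul_le_mul_left _ h'
        _ = (60 ^ 4) ^ 2 * ((120 ^ n) ^ 2 * (2 * n + 1) ^ 2) := by ring
        _ ≤ (60 ^ 4) ^ 2 * (400 * (60 ^ (4 * n / 3)) ^ 2) := Nat.mul_le_mul_left _ h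
        _ = _ := by ring

theorem IsGeneratorMatrix.dim_le {d n : ℕ} {A : Matrix (Fin d) (Fin n) (ZMod 2)}
    {C : BinaryCode n} (hA : IsGeneratorMatrix A C) : d ≤ n := by
  simpa using hA.1.fintype_card_le_finrank

theorem pow_mul_pow_le {d n : ℕ} (h : d ≤ n) : 60 ^ n * 2 ^ d ≤ 120 ^ n := by
  calc 60 ^ n * 2 ^ d ≤ 60 ^ n * 2 ^ n := Nat.mul_le_mul_left _ (Nat.pow_le_pow_right (by norm_num) h)
    _ = 120 ^ n := (mul_pow 60 2 n).symm

theorem update_get_empty (k : Stk) (l : List StkSym) :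
    (Function.update (fun _ => []) k l : Stk → List StkSym) = (({} : Store).set k l).get := by
  rw [← Store.update_get]
  refine congrArg (fun f : Stk → List StkSym => Function.update f k l) ?_
  funext j
  cases j <;> rfl

/-- The symbol of the input alphabet for a stack symbol. -/
def StkSym.toInput : StkSym → InputSymbol
  | .inp s => s
  | _ => .comma

theorem CodePair.length_encode_le (x : CodePair) : x.encode.length ≤ 3 * (2 * x.n + 1) ^ 2 := by
  have hC := Nat.mul_le_mul_right (x.n + 1) x.isGeneratorMatrixC.dim_le
  have hD := Nat.mul_le_mul_right (x.n + 1) x.isGeneratorMatrixD.dim_le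
  rw [x.length_encode]
  nlinarith

/-- The reduction on an instance with codes of length `n`. -/
theorem CodePair.reduction_runs (x : CodePair) : ∃ T, T ≤ 4000000 * (60 ^ (4 * x.n / 3)) ^ 2 ∧
    Runs reduction (Function.update (fun _ => []) .dest (x.encode.reverse.map .inp))
      (Function.update (fun _ => []) .out (if x.dimC = x.dimD then
        (codeTables (List.ofFn x.genC.row) (List.ofFn x.genD.row)).reverse.map .inp else [])) T := by
  have hC := x.isGeneratorMatrixC.dim_le
  have hD := x.isGeneratorMatrixD.dim_le
  -- There are at most $120^n$ words, each of length $n+d\le2n$.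
  have h := reduction_takes (n := x.n) (B := 120 ^ x.n) (m := 2 * x.n) (R := List.ofFn x.genC.row)
    (R' := List.ofFn x.genD.row) (by simpa using pow_mul_pow_le hC) (by simpa using pow_mul_pow_le hD)
    (by simp; omega) (by simp; omega) x.map_inp_encode
  refine ⟨reductionTime x.n (x.encode.map StkSym.inp).length (120 ^ x.n) (2 * x.n), ?_, ?_⟩
  rotate_left
  · rw [update_get_empty, update_get_empty, List.map_reverse, List.map_reverse]
    convert h using 1
    simp [Store.set]
    rfl
  · refine (reductionTime_le (Nat.one_le_pow _ _ (by norm_num)) (by omega) ?_).trans ?_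
    · rw [List.length_map]
      exact x.length_encode_le
    · have := sq_mul_pow_le x.n
      omega

theorem mainTheorem3 (t : ℕ → ℕ) (ht : Monotone t)
    (hiso : DecidableInTime FittingFreePair.encode FittingFreePair.Isomorphic
      (fun x => t x.order)) :
    DecidableInTime CodePair.encode CodePair.Equivalent (fun x => t (240 ^ x.n)) := by
  obtain ⟨M, c, hfin, hM⟩ := hiso
  obtain ⟨b, hb⟩ := sq_le_of_decides hM
  -- With $X=60^{2\lfloor4n/3\rfloor}\le b\,t(240^n)$, the input has at most $1200X$ symbols, and
  -- the reduction and the transfer of its output take at most $4000000X$ steps each; the rest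
  -- covers the two extra steps. The summand $c$ pays for the run of `M`.
  refine ⟨preprocessed M reduction .dest .out .inp StkSym.toInput, 8001203 * b + c, ?_, ?_⟩
  · rintro (k | k)
    · exact hfin k
    · exact inferInstanceAs (Finite StkSym)
  intro x answer hanswer
  obtain ⟨T, hT, hrun⟩ := x.reduction_runs
  have hX : (60 ^ (4 * x.n / 3)) ^ 2 ≤ b * t (240 ^ x.n) :=
    (hb _).trans (Nat.mul_le_mul_left b (ht (pow_div_le x.n)))
  have hX₁ : 1 ≤ (60 ^ (4 * x.n / 3)) ^ 2 := Nat.one_le_pow _ _ (by positivity)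
  have hs : x.encode.length ≤ 1200 * (60 ^ (4 * x.n / 3)) ^ 2 := by
    have h₁ := Nat.mul_le_mul_right ((2 * x.n + 1) ^ 2)
      (Nat.one_le_pow 2 (120 ^ x.n) (by positivity))
    have h₂ := sq_mul_pow_le x.n
    have h₃ := x.length_encode_le
    omega
  change Nonempty (Turing.TM2OutputsInTime _ _ _ ((8001203 * b + c) * t (240 ^ x.n)))
  rw [add_mul, mul_assoc]
  by_cases hdim : x.dimC = x.dimD
  · obtain ⟨y, hy, hyiso, hyenc⟩ := exists_pair x.isGeneratorMatrixC x.isGeneratorMatrixD hdim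
    rw [if_pos hdim, ← hyenc] at hrun
    -- Transferring the tables to `M` takes time proportional to their length, which is at most the
    -- time spent writing them.
    have hout := hrun.length_le .out
    rw [Function.update_self, Function.update_of_ne (by decide), List.length_map,
      List.length_reverse, List.length_nil, zero_add] at hout
    have hle : c * t y.order ≤ c * t (240 ^ x.n) := by
      refine Nat.mul_le_mul_left c (ht ?_)
      rw [hy]
      exact (pow_mul_pow_le x.isGeneratorMatrixC.dim_le).trans (Nat.pow_le_pow_left (by norm_num) _)
    have hne : y.encode ≠ [] := by simp [FittingFreePair.encode]
    obtain ⟨h⟩ := preprocessed_execute (u := c * t y.order) M reduction .dest .out .inp StkSym.toInput (fun _ => rfl)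
      hne hrun (hM y answer (hanswer.trans hyiso.symm))
    exact ⟨⟨h.1, h.2.trans (by omega)⟩⟩
  -- For different dimensions the groups have different orders, so they form no admissible instance
  -- for `M`; the empty output makes the machine answer no without running it.
  · have : answer = false := by
      rw [← Bool.not_eq_true, hanswer]
      exact fun h => hdim (h.dim_eq x.isGeneratorMatrixC x.isGeneratorMatrixD)
    subst this
    rw [if_neg hdim, Function.update_eq_self_iff.2 rfl] at hrun
    obtain ⟨h⟩ := preprocessed_reject M reduction .dest .out .inp StkSym.toInput hrun
    exact ⟨⟨h.1, h.2.trans (by omega)⟩⟩
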